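/- Let $d\ge 2$ be an integer, $p_0\in(1,d]$, $p_0'=p_0/(p_0-1)$, $\alpha\in(0,d/p_0]$, $k>0$, and let $r,s\in(p_0',\infty)$. Points of $\mathbb R^{d+1}$ are written $(t,x)$ with $t\in\mathbb R$, $x\in\mathbb R^d$, and $B_\rho(x)$ is the open ball of radius $\rho$ centered at $x$. For a measurable $g\ge 0$ on $\mathbb R^{d+1}$ put $$P_{\alpha,k}g(t,x)=\int_0^\infty\int_{\mathbb R^d}\frac{1}{\sigma^{(d+2-\alpha)/2}}\,e^{-|y|^2/(k\sigma)}\,g(t+\sigma,x+y)\,dy\,d\sigma\in[0,\infty],$$ $$\|g\|_{L_{r,s}}=\Big(\int_{\mathbb R}\Big(\int_{\mathbb R^d}|g(t,x)|^s\,dx\Big)^{r/s}dt\Big)^{1/r}\in[0,\infty],$$ and for a measurable $b$ on $\mathbb R^{d+1}$ let $$\tilde b_{\alpha,p_0}=\sup_{t\in\mathbb R}\ \sup_{\rho>0}\ \rho^{\alpha}\sup_{x\in\mathbb R^d}\Big(\frac1{|B_\rho(x)|}\int_{B_\rho(x)}|b(t,y)|^{p_0}\,dy\Big)^{1/p_0}\in[0,\infty]$$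 be its $(\alpha,p_0)$-Morrey norm. Theorem 2.2. There is a finite constant $N$, depending only on $d,\alpha,r,s,p_0,k$, such that for all (Lebesgue) measurable functions $b,f:\mathbb R^{d+1}\to[0,\infty)$ $$\|P_{\alpha,k}(bf)\|_{L_{r,s}}\le N\,\tilde b_{\alpha,p_0}\,\|f\|_{L_{r,s}},$$ with the convention $0\cdot\infty=0$ on the right-hand side. -/

import Mathlib

open MeasureTheory
open scoped ENNReal NNReal

noncomputable section

/-- Space-time `ℝ^{d+1}`: points `(t, x)` with `t` real and `x` in Euclidean `ℝ^d`; its `volume` is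
Lebesgue measure. -/
abbrev SpaceTime (d : ℕ) : Type := ℝ × EuclideanSpace ℝ (Fin d)

/-- The kernel `p_{α,k}(s, ρ) = s^{-(d+2-α)/2} exp(-ρ² / (k s)) I_{s > 0}`. -/
def parabolicKernel (d : ℕ) (α k s ρ : ℝ) : ℝ :=
  if 0 < s then 1 / s ^ (((d : ℝ) + 2 - α) / 2) * Real.exp (-ρ ^ 2 / (k * s)) else 0

/-- The parabolic potential of a nonnegative function `g`, a function with values in `[0, ∞]`:
`P_{α,k} g (t, x) = ∫ p_{α,k}(s, |y|) g(t + s, x + y) dy ds` over `ℝ^{d+1}`. -/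
def parabolicPotential {d : ℕ} (α k : ℝ) (g : SpaceTime d → ℝ≥0∞) (z : SpaceTime d) : ℝ≥0∞ :=
  ∫⁻ w : SpaceTime d, ENNReal.ofReal (parabolicKernel d α k w.1 ‖w.2‖) * g (z.1 + w.1, z.2 + w.2)

/-- The mixed norm `‖g‖_{L_{r,s}} = (∫ (∫ |g(t,x)|^s dx)^{r/s} dt)^{1/r}`, with exponent `r` in
time (outer integral) and `s` in space (inner integral). -/
def mixedNorm {d : ℕ} {V : Type*} [ENorm V] (r s : ℝ) (g : SpaceTime d → V) : ℝ≥0∞ :=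
  (∫⁻ t : ℝ, (∫⁻ x : EuclideanSpace ℝ (Fin d), ‖g (t, x)‖ₑ ^ s) ^ (r / s)) ^ (1 / r)

/-- The `(α, p₀)`-Morrey norm: the supremum over all times `t`, all radii `ρ > 0` and all centers
`x` of `ρ^α (⨍_{B_ρ(x)} |b(t,y)|^{p₀} dy)^{1/p₀}`. -/
def morreyNorm {d : ℕ} {V : Type*} [ENorm V] (α p₀ : ℝ) (b : SpaceTime d → V) : ℝ≥0∞ :=
  ⨆ (t : ℝ) (ρ : ℝ) (_ : 0 < ρ) (x : EuclideanSpace ℝ (Fin d)),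
    ENNReal.ofReal (ρ ^ α) * (⨍⁻ y in Metric.ball x ρ, ‖b (t, y)‖ₑ ^ p₀ ∂volume) ^ (1 / p₀)

end

set_option linter.unusedSectionVars false

/-! By duality it is enough to bound the integral of `f * b * P*g` for `g` in `L_{r',s'}`, where
`P*` is the adjoint potential and `r'`, `s'` are the conjugate exponents. The condition `s >
p₀/(p₀-1)` says precisely that `s' < p₀`. The kernel is at most a constant times `R^{-(d+2-α)}`,
with `R` the parabolic distance, and close points share a cell of one of finitely many shifted
grids. Hence `P*g` is dominated by finitely many dyadic sums `∑_j 4^{jα} A_j g`, where `A_j` takes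
means over boxes of size `16^j` in time and `4^j` in each space direction.

By Hölder's inequality it remains to bound `b ∑_j 4^{jα} A_j g` in `L_{r',s'}`. Fix the time, scale
the Morrey bound to 1, and put `q = s'`, `a_j = A_j g`, `c_j = b 4^{jα}`. Since `c_j` is geometric
in `j` and `p₀/q > 1`, the sum `∑ c_j a_j` is controlled by `sup_j max(1, c_j^{p₀/q}) a_j`
(`exists_tsum_geometric_mul_le`). After taking `q`-th powers this is at most `(sup_j a_j)^q + ∑_j
c_j^{p₀} a_j^q`, up to a constant. The Morrey condition bounds the means of `c_j^{p₀}` over cubes of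
side `4^j`, so a Carleson embedding (`lintegral_tsum_mul_rpow_le`) controls the integral of the
second term by that of the first.

Finally, `sup_j A_j g` is at most the maximal function in time of the maximal function in space. The
latter is bounded in `L_q` at each fixed time. The former is bounded in the mixed norm
(`maximal_mixed`), by weighted inequalities: with weights `φ`, `Mφ` and duality if `r' > s'`, and
with weights `(Mu)^{1-q₀}`, `u^{1-q₀}` and an extrapolation argument if `r' < s'`. -/

/-! ### Layer cake formulas for functions with values in `[0, ∞]`. -/

theorem ENNReal.rpow_eq_setLIntegral_Ioi {a : ℝ} (ha : 0 < a) (y : ℝ≥0∞) :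
    y ^ a = ∫⁻ t in Set.Ioi (0 : ℝ),
      ENNReal.ofReal (a * t ^ (a - 1)) * (if ENNReal.ofReal t < y then 1 else 0) := by
  have key : ∀ z : ℝ≥0, (z : ℝ≥0∞) ^ a = ∫⁻ t in Set.Ioi (0 : ℝ),
      ENNReal.ofReal (a * t ^ (a - 1)) * (if ENNReal.ofReal t < (z : ℝ≥0∞) then 1 else 0) := by
    intro z
    -- For a single finite value this is the usual layer cake formula for a constant function on a
    -- one-point space.
    have h := lintegral_rpow_eq_lintegral_meas_lt_mul (Measure.dirac ())
      (f := fun _ => (z : ℝ)) (Filter.Eventually.of_forall fun _ => z.2) aemeasurable_const ha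
    simp only [lintegral_dirac] at h
    rw [← ENNReal.ofReal_rpow_of_nonneg (NNReal.coe_nonneg z) ha.le, ENNReal.ofReal_coe_nnreal] at h
    rw [h, ← lintegral_const_mul' _ _ ENNReal.ofReal_ne_top]
    refine setLIntegral_congr_fun measurableSet_Ioi fun t ht => ?_
    have ht : 0 < t := ht
    rw [ENNReal.ofReal_mul ha.le]
    have : (ENNReal.ofReal t < (z : ℝ≥0∞)) ↔ t < z := by
      rw [ENNReal.ofReal_lt_iff_lt_toReal ht.le ENNReal.coe_ne_top]; simp
    by_cases h' : t < z
    · simp [this, h']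
    · simp [this, h']
  induction y using ENNReal.recTopCoe with
  | coe z => exact key z
  | top =>
    rw [ENNReal.top_rpow_of_pos ha]
    symm
    -- The right-hand side is monotone in `y` and takes every finite value at finite `y`, hence is
    -- infinite at `y = ∞`.
    refine ENNReal.eq_top_of_forall_nnreal_le fun r => ?_
    have h1 : (r : ℝ≥0∞) = ((r ^ (1 / a) : ℝ≥0) : ℝ≥0∞) ^ a := by
      rw [← ENNReal.coe_rpow_of_nonneg _ ha.le, ← NNReal.rpow_mul]
      simp [ha.ne']
    rw [h1, key]
    refine lintegral_mono fun t => ?_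
    gcongr
    split_ifs with h2 h3
    · exact le_rfl
    · simp at h3
    · exact bot_le
    · exact le_rfl

/-- The layer cake formula with a weight. -/
theorem lintegral_mul_rpow_eq_lintegral_setLIntegral {X : Type*} [MeasurableSpace X]
    (μ : Measure X) [SFinite μ] {F f : X → ℝ≥0∞} (hF : Measurable F) (hf : Measurable f)
    {a : ℝ} (ha : 0 < a) :
    ∫⁻ x, F x * f x ^ a ∂μ = ∫⁻ t in Set.Ioi (0 : ℝ),
      ENNReal.ofReal (a * t ^ (a - 1)) * ∫⁻ x in {x | ENNReal.ofReal t < f x}, F x ∂μ := by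
  have hms : MeasurableSet {p : X × ℝ | ENNReal.ofReal p.2 < f p.1} :=
    measurableSet_lt (ENNReal.measurable_ofReal.comp measurable_snd) (hf.comp measurable_fst)
  have h1 : ∀ x, F x * f x ^ a = ∫⁻ t in Set.Ioi (0 : ℝ),
      ENNReal.ofReal (a * t ^ (a - 1)) * ((if ENNReal.ofReal t < f x then 1 else 0) * F x) := by
    intro x
    rw [ENNReal.rpow_eq_setLIntegral_Ioi ha, mul_comm, ← lintegral_mul_const]
    · simp only [mul_assoc]
    · refine Measurable.mul (by fun_prop) (Measurable.ite ?_ measurable_const measurable_const)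
      exact measurableSet_lt ENNReal.measurable_ofReal measurable_const
  simp only [h1]
  rw [lintegral_lintegral_swap]
  · refine lintegral_congr fun t => ?_
    rw [lintegral_const_mul' _ _ ENNReal.ofReal_ne_top]
    congr 1
    rw [← lintegral_indicator (measurableSet_lt measurable_const hf)]
    refine lintegral_congr fun x => ?_
    by_cases h : ENNReal.ofReal t < f x <;> simp [h]
  · refine Measurable.aemeasurable ?_
    refine Measurable.mul (by fun_prop) (Measurable.mul
      (Measurable.ite hms measurable_const measurable_const) (by fun_prop))

/-! ### Nested partitions: stopping sets, averages, maximal function. -/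

/-- The set on which `k` is the first index with `a k` above the level `l`. -/
def firstHit {X : Type*} (a : ℕ → X → ℝ≥0∞) (l : ℝ≥0∞) : ℕ → Set X :=
  disjointed fun k => {x | l < a k x}

theorem firstHit_subset {X : Type*} (a : ℕ → X → ℝ≥0∞) (l : ℝ≥0∞) (k : ℕ) :
    firstHit a l k ⊆ {x | l < a k x} := disjointed_subset _ k

theorem iUnion_firstHit {X : Type*} (a : ℕ → X → ℝ≥0∞) (l : ℝ≥0∞) :
    ⋃ k, firstHit a l k = {x | l < ⨆ k, a k x} := by
  rw [firstHit, iUnion_disjointed]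
  ext x
  simp [lt_iSup_iff]

theorem mem_firstHit_iff {X : Type*} (a : ℕ → X → ℝ≥0∞) (l : ℝ≥0∞) (k : ℕ) (x : X) :
    x ∈ firstHit a l k ↔ l < a k x ∧ ∀ j < k, ¬ l < a j x := by
  simp [firstHit, disjointed_apply]

/-- A decreasing sequence of countable partitions of a measure space into cells of positive finite
measure; `idx k x` is the label of the cell of the `k`-th partition that contains `x`. -/
structure CellFiltration (X : Type*) [MeasurableSpace X] (μ : Measure X) (ι : Type*)
    [MeasurableSpace ι] where
  idx : ℕ → X → ι
  measurable_idx : ∀ k, Measurable (idx k)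
  nested : ∀ k x y, idx (k + 1) x = idx (k + 1) y → idx k x = idx k y
  measure_ne_zero : ∀ k x, μ {y | idx k y = idx k x} ≠ 0
  measure_ne_top : ∀ k x, μ {y | idx k y = idx k x} ≠ ∞

namespace CellFiltration

variable {X : Type*} [MeasurableSpace X] {μ : Measure X} {ι : Type*} [MeasurableSpace ι]

/-- The cell of the `k`-th partition that contains `x`. -/
def cell (𝒟 : CellFiltration X μ ι) (k : ℕ) (x : X) : Set X := {y | 𝒟.idx k y = 𝒟.idx k x}

/-- The mean of `f` over the cell of the `k`-th partition that contains `x`. -/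
noncomputable def avg (𝒟 : CellFiltration X μ ι) (k : ℕ) (f : X → ℝ≥0∞) (x : X) : ℝ≥0∞ :=
  (μ (𝒟.cell k x))⁻¹ * ∫⁻ y in 𝒟.cell k x, f y ∂μ

/-- The maximal function of `f` along the partitions. -/
noncomputable def maximal (𝒟 : CellFiltration X μ ι) (f : X → ℝ≥0∞) (x : X) : ℝ≥0∞ :=
  ⨆ k, 𝒟.avg k f x

/-- A set that is a union of cells of the `k`-th partition. -/
def Invariant (𝒟 : CellFiltration X μ ι) (k : ℕ) (E : Set X) : Prop :=
  ∀ x y, 𝒟.idx k x = 𝒟.idx k y → x ∈ E → y ∈ E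

variable (𝒟 : CellFiltration X μ ι)

theorem idx_eq_of_le {j k : ℕ} (hjk : j ≤ k) {x y : X} (h : 𝒟.idx k x = 𝒟.idx k y) :
    𝒟.idx j x = 𝒟.idx j y := by
  induction k, hjk using Nat.le_induction with
  | base => exact h
  | succ k _ ih => exact ih (𝒟.nested k x y h)

theorem cell_eq {k : ℕ} {x y : X} (h : 𝒟.idx k x = 𝒟.idx k y) : 𝒟.cell k x = 𝒟.cell k y := by
  simp [cell, h]

theorem avg_eq {k : ℕ} (f : X → ℝ≥0∞) {x y : X} (h : 𝒟.idx k x = 𝒟.idx k y) :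
    𝒟.avg k f x = 𝒟.avg k f y := by
  simp [avg, 𝒟.cell_eq h]

theorem avg_le_maximal (k : ℕ) (f : X → ℝ≥0∞) (x : X) : 𝒟.avg k f x ≤ 𝒟.maximal f x :=
  le_iSup (fun k => 𝒟.avg k f x) k

theorem avg_mono (k : ℕ) {f g : X → ℝ≥0∞} (h : f ≤ g) (x : X) : 𝒟.avg k f x ≤ 𝒟.avg k g x := by
  unfold avg
  gcongr
  exact h _

/-- Whether `k` is the first hit is decided by `a j` for `j ≤ k`, and each of these is constant on
cells of level `k` because the partitions are nested. -/
theorem invariant_firstHit {a : ℕ → X → ℝ≥0∞}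
    (ha : ∀ k x y, 𝒟.idx k x = 𝒟.idx k y → a k x = a k y) (l : ℝ≥0∞) (k : ℕ) :
    𝒟.Invariant k (firstHit a l k) := by
  intro x y hxy hx
  rw [mem_firstHit_iff] at *
  refine ⟨?_, fun j hj => ?_⟩
  · rw [← ha k x y hxy]; exact hx.1
  · rw [← ha j x y (𝒟.idx_eq_of_le hj.le hxy)]; exact hx.2 j hj

theorem invariant_firstHit_avg (f : X → ℝ≥0∞) (l : ℝ≥0∞) (k : ℕ) :
    𝒟.Invariant k (firstHit (fun k => 𝒟.avg k f) l k) :=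
  𝒟.invariant_firstHit (a := fun k => 𝒟.avg k f) (fun _ _ _ h => 𝒟.avg_eq f h) l k

theorem avg_const (k : ℕ) (c : ℝ≥0∞) (x : X) : 𝒟.avg k (fun _ => c) x = c := by
  unfold avg
  rw [setLIntegral_const, mul_comm c, ← mul_assoc,
    ENNReal.inv_mul_cancel (a := μ (𝒟.cell k x)) (𝒟.measure_ne_zero k x) (𝒟.measure_ne_top k x),
    one_mul]

theorem avg_const_add (k : ℕ) (c : ℝ≥0∞) (f : X → ℝ≥0∞) (x : X) :
    𝒟.avg k (fun y => c + f y) x = c + 𝒟.avg k f x := by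
  conv_rhs => rw [← 𝒟.avg_const k c x]
  unfold avg
  rw [lintegral_add_left measurable_const, mul_add]

variable [DiscreteMeasurableSpace ι]

theorem measurableSet_cell (k : ℕ) (x : X) : MeasurableSet (𝒟.cell k x) :=
  𝒟.measurable_idx k (MeasurableSet.of_discrete (s := {𝒟.idx k x}))

theorem Invariant.measurableSet {k : ℕ} {E : Set X} (hE : 𝒟.Invariant k E) :
    MeasurableSet E := by
  have : E = 𝒟.idx k ⁻¹' (𝒟.idx k '' E) := by
    ext x
    constructor
    · intro hx; exact ⟨x, hx, rfl⟩
    · rintro ⟨y, hy, hyx⟩; exact hE y x hyx hy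
  rw [this]
  exact 𝒟.measurable_idx k MeasurableSet.of_discrete

variable [Countable ι]

/-- There are countably many cells, and on each of them the average is a measurable function of the
parameter alone. -/
theorem measurable_avg_prod {Y : Type*} [MeasurableSpace Y] [SFinite μ] (k : ℕ)
    {h : X × Y → ℝ≥0∞} (hh : Measurable h) :
    Measurable fun p : X × Y => 𝒟.avg k (fun s => h (s, p.2)) p.1 := by
  have h1 : ∀ (S : Set X), Measurable fun y => ∫⁻ s in S, h (s, y) ∂μ :=
    fun S => hh.lintegral_prod_left'
  have h2 : ∀ i, Measurable fun y : Y =>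
      (μ {y | 𝒟.idx k y = i})⁻¹ * ∫⁻ s in {y | 𝒟.idx k y = i}, h (s, y) ∂μ :=
    fun i => (h1 {y | 𝒟.idx k y = i}).const_mul (μ {y | 𝒟.idx k y = i})⁻¹
  have h3 : Measurable (Function.uncurry fun (i : ι) (y : Y) =>
      (μ {y | 𝒟.idx k y = i})⁻¹ * ∫⁻ s in {y | 𝒟.idx k y = i}, h (s, y) ∂μ) :=
    measurable_from_prod_countable_right h2
  have h4 : Measurable fun p : X × Y => (𝒟.idx k p.1, p.2) :=
    ((𝒟.measurable_idx k).comp measurable_fst).prodMk measurable_snd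
  have h5 := h3.comp h4
  simp only [Function.comp_def, Function.uncurry_apply_pair] at h5
  simpa only [avg, cell] using h5

theorem measurable_avg (k : ℕ) (f : X → ℝ≥0∞) : Measurable (𝒟.avg k f) := by
  let G : ι → ℝ≥0∞ := fun q =>
    (μ {y | 𝒟.idx k y = q})⁻¹ * ∫⁻ s in {y | 𝒟.idx k y = q}, f s ∂μ
  exact (measurable_of_countable G).comp (𝒟.measurable_idx k)

theorem measurable_maximal (f : X → ℝ≥0∞) : Measurable (𝒟.maximal f) :=
  Measurable.iSup fun k => 𝒟.measurable_avg k f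

theorem measurable_maximal_prod {Y : Type*} [MeasurableSpace Y] [SFinite μ]
    {h : X × Y → ℝ≥0∞} (hh : Measurable h) :
    Measurable fun p : X × Y => 𝒟.maximal (fun s => h (s, p.2)) p.1 :=
  Measurable.iSup fun k => 𝒟.measurable_avg_prod k hh

/-- Averaging is self-adjoint on unions of cells. -/
theorem setLIntegral_avg_mul [SFinite μ] {k : ℕ} {E : Set X} (hE : 𝒟.Invariant k E)
    {f φ : X → ℝ≥0∞} (hf : Measurable f) (hφ : Measurable φ) :
    ∫⁻ x in E, 𝒟.avg k f x * φ x ∂μ = ∫⁻ x in E, f x * 𝒟.avg k φ x ∂μ := by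
  have hEm := Invariant.measurableSet 𝒟 hE
  -- On `E` the averaging operator has the kernel `K`, which is symmetric because `E` is a union of
  -- cells; self-adjointness is then Tonelli's theorem.
  let D : Set (X × X) := {p | 𝒟.idx k p.2 = 𝒟.idx k p.1 ∧ p.1 ∈ E}
  let K : X → X → ℝ≥0∞ := fun x y => D.indicator (fun p => (μ (𝒟.cell k p.1))⁻¹) (x, y)
  have hKs : ∀ x y, K x y = K y x := by
    intro x y
    by_cases h : 𝒟.idx k y = 𝒟.idx k x
    · have : x ∈ E ↔ y ∈ E := ⟨hE x y h.symm, hE y x h⟩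
      have hD : (x, y) ∈ D ↔ (y, x) ∈ D := by simp [D, h, this]
      simp only [K, Set.indicator, 𝒟.cell_eq h]
      congr 1
      exact propext hD
    · have h1 : (x, y) ∉ D := fun hp => h hp.1
      have h2 : (y, x) ∉ D := fun hp => h hp.1.symm
      simp only [K, Set.indicator_of_notMem h1, Set.indicator_of_notMem h2]
  have hKm : Measurable (Function.uncurry K) := by
    refine Measurable.indicator (f := fun p : X × X => (μ (𝒟.cell k p.1))⁻¹) ?_ ?_
    · have h1 : Measurable fun i : ι => (μ {y | 𝒟.idx k y = i})⁻¹ := measurable_of_countable _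
      exact h1.comp ((𝒟.measurable_idx k).comp measurable_fst)
    · refine MeasurableSet.inter ?_ (measurable_fst hEm)
      have : Measurable fun p : X × X => (𝒟.idx k p.2, 𝒟.idx k p.1) :=
        ((𝒟.measurable_idx k).comp measurable_snd).prodMk ((𝒟.measurable_idx k).comp measurable_fst)
      exact this (MeasurableSet.of_discrete (s := {q : ι × ι | q.1 = q.2}))
  have key : ∀ (f φ : X → ℝ≥0∞), Measurable f → Measurable φ →
      ∫⁻ x in E, 𝒟.avg k f x * φ x ∂μ = ∫⁻ x, ∫⁻ y, K x y * f y * φ x ∂μ ∂μ := by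
    intro f φ hf hφ
    rw [← lintegral_indicator hEm]
    refine lintegral_congr fun x => ?_
    have hKf : Measurable fun y => K x y * f y := (hKm.of_uncurry_left).mul hf
    rw [lintegral_mul_const _ hKf]
    by_cases hx : x ∈ E
    · rw [Set.indicator_of_mem hx]
      congr 1
      unfold avg
      rw [← lintegral_const_mul _ hf, ← lintegral_indicator (𝒟.measurableSet_cell k x)]
      refine lintegral_congr fun y => ?_
      by_cases hy : 𝒟.idx k y = 𝒟.idx k x
      · have : y ∈ 𝒟.cell k x := hy
        have hp : (x, y) ∈ D := ⟨hy, hx⟩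
        simp [K, this, hp]
      · have : y ∉ 𝒟.cell k x := hy
        have hp : (x, y) ∉ D := fun hp => hy hp.1
        simp [K, this, hp]
    · have hp : ∀ y, (x, y) ∉ D := fun y hp => hx hp.2
      simp [K, hx, hp]
  rw [key f φ hf hφ]
  simp only [mul_comm (f _) (𝒟.avg k φ _)]
  rw [key φ f hφ hf, lintegral_lintegral_swap]
  · refine lintegral_congr fun x => lintegral_congr fun y => ?_
    rw [hKs y x, mul_right_comm]
  · refine Measurable.aemeasurable ?_
    exact (hKm.mul (hf.comp measurable_snd)).mul (hφ.comp measurable_fst)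

/-! ### Weighted inequalities for the maximal function. -/

/-- A pair of weights for which averaging over cells is bounded in `L_q`. -/
def WeightPair (q : ℝ) (W V : X → ℝ≥0∞) : Prop :=
  ∀ (k : ℕ) (h : X → ℝ≥0∞) (E : Set X), Measurable h → 𝒟.Invariant k E →
    ∫⁻ x in E, 𝒟.avg k h x ^ q * W x ∂μ ≤ ∫⁻ x in E, h x ^ q * V x ∂μ

variable {𝒟}

/-- The level set of the maximal function is the disjoint union of the stopping sets. On the `k`-th
one the average of level `k` exceeds `l`, and the weight inequality for that single level applies
because the set is a union of its cells. -/
theorem WeightPair.weak_type {q : ℝ} (hq : 0 < q) {W V : X → ℝ≥0∞} (hWV : 𝒟.WeightPair q W V)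
    {h : X → ℝ≥0∞} (hh : Measurable h) (l : ℝ≥0∞) :
    l ^ q * ∫⁻ x in {x | l < 𝒟.maximal h x}, W x ∂μ ≤ ∫⁻ x, h x ^ q * V x ∂μ := by
  have hE := fun k => 𝒟.invariant_firstHit_avg h l k
  have hEm := fun k => Invariant.measurableSet 𝒟 (hE k)
  have hd : Pairwise (Function.onFun Disjoint (firstHit (fun k => 𝒟.avg k h) l)) :=
    disjoint_disjointed _
  calc l ^ q * ∫⁻ x in {x | l < 𝒟.maximal h x}, W x ∂μ
      = ∑' k, l ^ q * ∫⁻ x in firstHit (fun k => 𝒟.avg k h) l k, W x ∂μ := by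
        rw [ENNReal.tsum_mul_left, ← lintegral_iUnion hEm hd, iUnion_firstHit]; rfl
    _ ≤ ∑' k, ∫⁻ x in firstHit (fun k => 𝒟.avg k h) l k, h x ^ q * V x ∂μ := by
        refine ENNReal.tsum_le_tsum fun k => ?_
        refine le_trans ?_ (hWV k h _ hh (hE k))
        refine (lintegral_const_mul_le _ _).trans ?_
        refine setLIntegral_mono' (hEm k) fun x hx => ?_
        gcongr
        exact (firstHit_subset _ _ _ hx).le
    _ = ∫⁻ x in ⋃ k, firstHit (fun k => 𝒟.avg k h) l k, h x ^ q * V x ∂μ :=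
        (lintegral_iUnion hEm hd _).symm
    _ ≤ ∫⁻ x, h x ^ q * V x ∂μ := setLIntegral_le_lintegral _ _

end CellFiltration

namespace CellFiltration

variable {X : Type*} [MeasurableSpace X] {μ : Measure X} {ι : Type*} [MeasurableSpace ι]
  [DiscreteMeasurableSpace ι] [Countable ι] {𝒟 : CellFiltration X μ ι}

/-- The part of `h` below `t / 2` contributes at most `t / 2` to any average. This truncation lets
the weak-type bound at exponent `q₀` be integrated in the level to give the strong bound at `q >
q₀`. -/
theorem setOf_lt_maximal_subset (h : X → ℝ≥0∞) {t : ℝ} (ht : 0 < t) :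
    {x | ENNReal.ofReal t < 𝒟.maximal h x} ⊆
      {x | ENNReal.ofReal (t / 2) <
        𝒟.maximal ({x | ENNReal.ofReal (t / 2) < h x}.indicator h) x} := by
  intro x hx
  have hx : ENNReal.ofReal t < 𝒟.maximal h x := hx
  show ENNReal.ofReal (t / 2) < 𝒟.maximal ({x | ENNReal.ofReal (t / 2) < h x}.indicator h) x
  by_contra hcon
  rw [not_lt] at hcon
  refine absurd hx (not_lt.2 (iSup_le fun k => ?_))
  have h1 : h ≤ fun y => ENNReal.ofReal (t / 2) +
      {x | ENNReal.ofReal (t / 2) < h x}.indicator h y := by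
    intro y
    by_cases hy : ENNReal.ofReal (t / 2) < h y
    · simp only [Set.indicator_of_mem (show y ∈ {x | ENNReal.ofReal (t / 2) < h x} from hy)]
      exact le_add_self
    · exact (not_lt.1 hy).trans le_self_add
  calc 𝒟.avg k h x ≤ _ := 𝒟.avg_mono k h1 x
    _ = ENNReal.ofReal (t / 2) + 𝒟.avg k _ x := 𝒟.avg_const_add k _ _ x
    _ ≤ ENNReal.ofReal (t / 2) + ENNReal.ofReal (t / 2) := by
        gcongr; exact (𝒟.avg_le_maximal k _ x).trans hcon
    _ = ENNReal.ofReal t := by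
        rw [← ENNReal.ofReal_add (by positivity) (by positivity), add_halves]

/-- Boundedness of the maximal function between the members of a weight pair. -/
theorem WeightPair.strong_type [SFinite μ] {q₀ q : ℝ} (hq₀ : 0 < q₀) (hq : q₀ < q)
    {W V : X → ℝ≥0∞} (hW : Measurable W) (hV : Measurable V) (hWV : 𝒟.WeightPair q₀ W V)
    {h : X → ℝ≥0∞} (hh : Measurable h) :
    ∫⁻ x, 𝒟.maximal h x ^ q * W x ∂μ ≤
      ENNReal.ofReal (2 ^ q * q / (q - q₀)) * ∫⁻ x, h x ^ q * V x ∂μ := by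
  have hqq : 0 < q - q₀ := sub_pos.2 hq
  have hq' : 0 < q := hq₀.trans hq
  set C : ℝ := 2 ^ q₀ * q / (q - q₀) with hC
  have hC0 : 0 ≤ C := by positivity
  simp only [mul_comm _ (W _)]
  rw [lintegral_mul_rpow_eq_lintegral_setLIntegral μ hW (𝒟.measurable_maximal h) hq']
  have step : ∀ t ∈ Set.Ioi (0 : ℝ), ENNReal.ofReal (q * t ^ (q - 1)) *
      ∫⁻ x in {x | ENNReal.ofReal t < 𝒟.maximal h x}, W x ∂μ ≤
      ENNReal.ofReal C * (ENNReal.ofReal ((q - q₀) * t ^ (q - q₀ - 1)) *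
        ∫⁻ x in {x | ENNReal.ofReal t < 2 * h x}, h x ^ q₀ * V x ∂μ) := by
    intro t ht
    have ht : 0 < t := ht
    set S : Set X := {x | ENNReal.ofReal (t / 2) < h x} with hS
    have hSm : MeasurableSet S := measurableSet_lt measurable_const hh
    have hSe : S = {x | ENNReal.ofReal t < 2 * h x} := by
      ext x
      have : ENNReal.ofReal t = 2 * ENNReal.ofReal (t / 2) := by
        rw [← ENNReal.ofReal_ofNat, ← ENNReal.ofReal_mul (by norm_num)]
        congr 1; ring
      show ENNReal.ofReal (t / 2) < h x ↔ ENNReal.ofReal t < 2 * h x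
      rw [this, ENNReal.mul_lt_mul_iff_right (by norm_num) (by norm_num)]
    have hweak := hWV.weak_type hq₀ (hh.indicator hSm) (ENNReal.ofReal (t / 2))
    have hr : ∫⁻ x, S.indicator h x ^ q₀ * V x ∂μ = ∫⁻ x in S, h x ^ q₀ * V x ∂μ := by
      rw [← lintegral_indicator hSm]
      refine lintegral_congr fun x => ?_
      by_cases hx : x ∈ S
      · simp [hx]
      · simp [hx, hq₀]
    rw [hr, hSe] at hweak
    -- The factor `(t / 2) ^ q₀` is set aside for the weak-type bound at level `t / 2`; what remains
    -- is the layer cake density for the exponent `q - q₀`.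
    have hid : q * t ^ (q - 1) = C * ((q - q₀) * t ^ (q - q₀ - 1)) * (t / 2) ^ q₀ := by
      rw [hC, Real.div_rpow ht.le (by norm_num)]
      have e : t ^ (q - 1) = t ^ (q - q₀ - 1) * t ^ q₀ := by
        rw [← Real.rpow_add ht]; congr 1; ring
      have : (2 : ℝ) ^ q₀ ≠ 0 := by positivity
      rw [e]; field_simp
    rw [hid, ENNReal.ofReal_mul (by positivity), ENNReal.ofReal_mul hC0,
      ← ENNReal.ofReal_rpow_of_nonneg (by positivity) hq₀.le, mul_assoc, mul_assoc]
    gcongr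
    refine le_trans ?_ hweak
    have := setOf_lt_maximal_subset (𝒟 := 𝒟) h ht
    rw [← hS, hSe] at this
    exact mul_le_mul' le_rfl (lintegral_mono_set this)
  refine (setLIntegral_mono' measurableSet_Ioi step).trans ?_
  have hhV : Measurable fun x => h x ^ q₀ * V x := (hh.pow_const q₀).mul hV
  rw [lintegral_const_mul' _ _ ENNReal.ofReal_ne_top,
    ← lintegral_mul_rpow_eq_lintegral_setLIntegral μ hhV (hh.const_mul 2) hqq]
  have hfin : ∀ x, h x ^ q₀ * V x * (2 * h x) ^ (q - q₀) =
      ENNReal.ofReal (2 ^ (q - q₀)) * (h x ^ q * V x) := by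
    intro x
    rw [ENNReal.mul_rpow_of_nonneg _ _ hqq.le]
    have e : h x ^ q = h x ^ q₀ * h x ^ (q - q₀) := by
      rw [← ENNReal.rpow_add_of_nonneg _ _ hq₀.le hqq.le]; congr 1; ring
    rw [e, ← ENNReal.ofReal_rpow_of_nonneg (by norm_num) hqq.le, ENNReal.ofReal_ofNat]
    ring
  simp only [hfin]
  rw [lintegral_const_mul' _ _ ENNReal.ofReal_ne_top, ← mul_assoc, ← ENNReal.ofReal_mul hC0]
  refine le_of_eq ?_
  congr 2
  rw [hC]
  have e : (2 : ℝ) ^ q = 2 ^ q₀ * 2 ^ (q - q₀) := by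
    rw [← Real.rpow_add (by norm_num)]; congr 1; ring
  rw [e]; ring

/-- The dyadic Fefferman–Stein inequality: the average is moved onto the weight by self-adjointness
and then bounded by the maximal function. -/
theorem weightPair_maximal [SFinite μ] {φ : X → ℝ≥0∞} (hφ : Measurable φ) :
    𝒟.WeightPair 1 φ (𝒟.maximal φ) := by
  intro k h E hh hE
  simp only [ENNReal.rpow_one]
  rw [𝒟.setLIntegral_avg_mul hE hh hφ]
  refine lintegral_mono fun x => ?_
  gcongr
  exact 𝒟.avg_le_maximal k φ x

theorem weightPair_one [SFinite μ] : 𝒟.WeightPair 1 (fun _ => 1) (fun _ => 1) := by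
  intro k h E hh hE
  simp only [ENNReal.rpow_one]
  rw [𝒟.setLIntegral_avg_mul hE hh measurable_const]
  simp only [𝒟.avg_const]
  exact le_rfl

/-- The maximal function is bounded in `L_q`, `q > 1`. -/
theorem lintegral_maximal_rpow_le [SFinite μ] {q : ℝ} (hq : 1 < q) {h : X → ℝ≥0∞}
    (hh : Measurable h) :
    ∫⁻ x, 𝒟.maximal h x ^ q ∂μ ≤ ENNReal.ofReal (2 ^ q * q / (q - 1)) * ∫⁻ x, h x ^ q ∂μ := by
  simpa using weightPair_one.strong_type (𝒟 := 𝒟) one_pos hq measurable_const measurable_const hh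

theorem ennreal_rpow_mul_rpow_neg_le_one (x : ℝ≥0∞) (a : ℝ) : x ^ a * x ^ (-a) ≤ 1 := by
  rw [ENNReal.rpow_neg]
  exact ENNReal.mul_inv_le_one _

/-- Hölder's inequality on one cell for `h = (h u^{(1-q)/q}) u^{(q-1)/q}`. Positivity and finiteness
of `u` make the two powers of `u` cancel. -/
theorem avg_rpow_mul_le {q : ℝ} (hq : 1 < q) (k : ℕ) {h u : X → ℝ≥0∞} (hh : Measurable h)
    (hu : Measurable u) (hu0 : ∀ x, u x ≠ 0) (hut : ∀ x, u x ≠ ∞) (x : X) :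
    𝒟.avg k h x ^ q * 𝒟.avg k u x ^ (1 - q) ≤ 𝒟.avg k (fun y => h y ^ q * u y ^ (1 - q)) x := by
  have hq0 : 0 < q := by linarith
  have hint : ∫⁻ y in 𝒟.cell k x, h y ∂μ ≤
      (∫⁻ y in 𝒟.cell k x, h y ^ q * u y ^ (1 - q) ∂μ) ^ (1 / q) *
        (∫⁻ y in 𝒟.cell k x, u y ∂μ) ^ ((q - 1) / q) := by
    have hm : Measurable fun y => h y ^ q * u y ^ (1 - q) :=
      (hh.pow_const q).mul (hu.pow_const (1 - q))
    refine le_trans (le_of_eq ?_) (ENNReal.lintegral_mul_norm_pow_le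
      hm.aemeasurable hu.aemeasurable
      (by positivity) (div_nonneg (by linarith) hq0.le) (by field_simp; ring))
    refine lintegral_congr fun y => ?_
    rw [ENNReal.mul_rpow_of_nonneg _ _ (by positivity), ← ENNReal.rpow_mul, ← ENNReal.rpow_mul,
      mul_one_div_cancel hq0.ne', ENNReal.rpow_one, mul_assoc,
      ← ENNReal.rpow_add _ _ (hu0 y) (hut y)]
    have : (1 - q) * (1 / q) + (q - 1) / q = 0 := by field_simp; ring
    rw [this, ENNReal.rpow_zero, mul_one]
  set m := (μ (𝒟.cell k x))⁻¹ with hm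
  have hm0 : m ≠ 0 := ENNReal.inv_ne_zero.2 (𝒟.measure_ne_top k x)
  have hmt : m ≠ ∞ := ENNReal.inv_ne_top.2 (𝒟.measure_ne_zero k x)
  have h1 : 𝒟.avg k h x ^ q ≤
      𝒟.avg k (fun y => h y ^ q * u y ^ (1 - q)) x * 𝒟.avg k u x ^ (q - 1) := by
    unfold avg
    rw [← hm]
    have h2 : (m * ∫⁻ y in 𝒟.cell k x, h y ∂μ) ^ q ≤ (m *
      ((∫⁻ y in 𝒟.cell k x, h y ^ q * u y ^ (1 - q) ∂μ) ^ (1 / q) *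
        (∫⁻ y in 𝒟.cell k x, u y ∂μ) ^ ((q - 1) / q))) ^ q := by gcongr
    refine h2.trans (le_of_eq ?_)
    rw [ENNReal.mul_rpow_of_nonneg _ _ hq0.le, ENNReal.mul_rpow_of_nonneg _ _ hq0.le,
      ← ENNReal.rpow_mul, ← ENNReal.rpow_mul, one_div_mul_cancel hq0.ne', ENNReal.rpow_one,
      div_mul_cancel₀ _ hq0.ne', ENNReal.mul_rpow_of_nonneg _ _ (by linarith : 0 ≤ q - 1)]
    have e : m ^ q = m * m ^ (q - 1) := by
      conv_rhs => rw [← ENNReal.rpow_one m, ← ENNReal.rpow_mul, one_mul]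
      rw [← ENNReal.rpow_add _ _ hm0 hmt]
      congr 1; ring
    rw [e]; ring
  calc 𝒟.avg k h x ^ q * 𝒟.avg k u x ^ (1 - q)
      ≤ 𝒟.avg k (fun y => h y ^ q * u y ^ (1 - q)) x * 𝒟.avg k u x ^ (q - 1) *
          𝒟.avg k u x ^ (1 - q) := by gcongr
    _ = 𝒟.avg k (fun y => h y ^ q * u y ^ (1 - q)) x *
        (𝒟.avg k u x ^ (q - 1) * 𝒟.avg k u x ^ (-(q - 1))) := by rw [neg_sub, mul_assoc]
    _ ≤ 𝒟.avg k (fun y => h y ^ q * u y ^ (1 - q)) x * 1 := by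
        gcongr; exact ennreal_rpow_mul_rpow_neg_le_one _ _
    _ = _ := mul_one _

/-- As `1 - q < 0`, replacing the average of `u` by its maximal function only decreases the weight.
The one-cell inequality then leaves an average integrated against 1, and averaging preserves
integrals over unions of cells. -/
theorem weightPair_rpow [SFinite μ] {q : ℝ} (hq : 1 < q) {u : X → ℝ≥0∞} (hu : Measurable u)
    (hu0 : ∀ x, u x ≠ 0) (hut : ∀ x, u x ≠ ∞) :
    𝒟.WeightPair q (fun x => 𝒟.maximal u x ^ (1 - q)) (fun x => u x ^ (1 - q)) := by
  intro k h E hh hE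
  have hm : Measurable fun y => h y ^ q * u y ^ (1 - q) :=
    (hh.pow_const q).mul (hu.pow_const (1 - q))
  calc ∫⁻ x in E, 𝒟.avg k h x ^ q * 𝒟.maximal u x ^ (1 - q) ∂μ
      ≤ ∫⁻ x in E, 𝒟.avg k (fun y => h y ^ q * u y ^ (1 - q)) x * 1 ∂μ := by
        refine lintegral_mono fun x => ?_
        simp only [mul_one]
        refine le_trans ?_ (avg_rpow_mul_le hq k hh hu hu0 hut x)
        rw [← neg_sub, ENNReal.rpow_neg, ENNReal.rpow_neg]
        have hq1 : 0 ≤ q - 1 := by linarith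
        gcongr
        exact 𝒟.avg_le_maximal k u x
    _ = ∫⁻ x in E, h x ^ q * u x ^ (1 - q) ∂μ := by
        rw [𝒟.setLIntegral_avg_mul hE hm measurable_const]
        simp only [𝒟.avg_const, mul_one]

end CellFiltration

/-! ### Duality for mixed norms. -/

/-- The converse of Hölder's inequality in mixed norm spaces. -/
theorem mixed_norm_le_of_forall_lintegral_mul_le {T X : Type*} [MeasurableSpace T]
    [MeasurableSpace X] (μ : Measure T) (ν : Measure X) [SigmaFinite μ] [SigmaFinite ν]
    {r s r' s' : ℝ} (hr : r.HolderConjugate r') (hs : s.HolderConjugate s')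
    {F : T × X → ℝ≥0∞} (hF : Measurable F) {C : ℝ≥0∞}
    (H : ∀ g : T × X → ℝ≥0∞, Measurable g → ∫⁻ t, ∫⁻ x, F (t, x) * g (t, x) ∂ν ∂μ ≤
      C * (∫⁻ t, (∫⁻ x, g (t, x) ^ s' ∂ν) ^ (r' / s') ∂μ) ^ (1 / r')) :
    (∫⁻ t, (∫⁻ x, F (t, x) ^ s ∂ν) ^ (r / s) ∂μ) ^ (1 / r) ≤ C := by
  have hr0 := hr.pos
  have hs0 := hs.pos
  have hr0' := hr.symm.pos
  have hs0' := hs.symm.pos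
  have hs1 : 0 < s - 1 := by linarith [hs.lt]
  let S : ℕ → Set (T × X) := fun k => spanningSets μ k ×ˢ spanningSets ν k
  have hSm : ∀ k, MeasurableSet (S k) := fun k =>
    (measurableSet_spanningSets μ k).prod (measurableSet_spanningSets ν k)
  -- Bounded truncations of `F` supported in products of sets of finite measure. Their norms are
  -- finite, which permits the final division; monotone convergence then recovers `F`.
  let G : ℕ → T × X → ℝ≥0∞ := fun k => (S k).indicator fun z => min (F z) k
  have hGm : ∀ k, Measurable (G k) := fun k => (hF.min measurable_const).indicator (hSm k)
  have hGF : ∀ k z, G k z ≤ F z := fun k z =>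
    (Set.indicator_le_self' (fun _ _ => bot_le) z).trans (min_le_left _ _)
  have hSmono : Monotone S := fun j k hjk => Set.prod_mono
    (monotone_spanningSets μ hjk) (monotone_spanningSets ν hjk)
  have hGmono : ∀ z, Monotone fun k => G k z := by
    intro z j k hjk
    refine (Set.indicator_le_indicator_of_subset (hSmono hjk) (fun _ => bot_le) z).trans ?_
    refine Set.indicator_le_indicator ?_
    exact min_le_min le_rfl (by exact_mod_cast hjk)
  have hGlim : ∀ z, Filter.Tendsto (fun k => G k z) Filter.atTop (nhds (F z)) := by
    intro z
    have h1 : ∀ᶠ k in Filter.atTop, z ∈ S k := by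
      have ht : z.1 ∈ ⋃ k, spanningSets μ k := by rw [iUnion_spanningSets]; trivial
      have hx : z.2 ∈ ⋃ k, spanningSets ν k := by rw [iUnion_spanningSets]; trivial
      obtain ⟨i, hi⟩ := Set.mem_iUnion.1 ht
      obtain ⟨j, hj⟩ := Set.mem_iUnion.1 hx
      filter_upwards [Filter.eventually_ge_atTop (max i j)] with k hk
      exact ⟨monotone_spanningSets μ ((le_max_left _ _).trans hk) hi,
        monotone_spanningSets ν ((le_max_right _ _).trans hk) hj⟩
    have h2 : Filter.Tendsto (fun k : ℕ => min (F z) (k : ℝ≥0∞)) Filter.atTop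
        (nhds (min (F z) ∞)) := tendsto_const_nhds.min ENNReal.tendsto_nat_nhds_top
    rw [min_eq_left le_top] at h2
    refine h2.congr' ?_
    filter_upwards [h1] with k hk
    simp [G, hk]
  let N : ℕ → T → ℝ≥0∞ := fun k t => ∫⁻ x, G k (t, x) ^ s ∂ν
  have hNm : ∀ k, Measurable (N k) := fun k => ((hGm k).pow_const s).lintegral_prod_right'
  have hNle : ∀ k t, N k t ≤ (spanningSets μ k).indicator
      (fun _ => (k : ℝ≥0∞) ^ s * ν (spanningSets ν k)) t := by
    intro k t
    by_cases ht : t ∈ spanningSets μ k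
    · rw [Set.indicator_of_mem ht, ← setLIntegral_const,
        ← lintegral_indicator (measurableSet_spanningSets ν k)]
      refine lintegral_mono fun x => ?_
      by_cases hx : x ∈ spanningSets ν k
      · have : (t, x) ∈ S k := ⟨ht, hx⟩
        simp only [G, Set.indicator_of_mem this, Set.indicator_of_mem hx]
        gcongr
        exact min_le_right _ _
      · have : (t, x) ∉ S k := fun h => hx h.2
        simp [G, this, hs0]
    · refine le_of_eq ?_
      rw [Set.indicator_of_notMem ht]
      have : ∀ x, (t, x) ∉ S k := fun x h => ht h.1
      simp [N, G, this, hs0]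
  have hKfin : ∀ k : ℕ, (k : ℝ≥0∞) ^ s * ν (spanningSets ν k) ≠ ∞ := fun k =>
    ENNReal.mul_ne_top (ENNReal.rpow_ne_top_of_nonneg hs0.le (ENNReal.natCast_ne_top k))
      (measure_spanningSets_lt_top ν k).ne
  have hNfin : ∀ k t, N k t ≠ ∞ := by
    intro k t
    refine ((hNle k t).trans (Set.indicator_le_self' (fun _ _ => bot_le) t)).trans_lt ?_ |>.ne
    exact (hKfin k).lt_top
  have hI : ∀ k, ∫⁻ t, N k t ^ (r / s) ∂μ ≠ ∞ := by
    intro k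
    have : ∫⁻ t, N k t ^ (r / s) ∂μ ≤
        ∫⁻ t in spanningSets μ k, ((k : ℝ≥0∞) ^ s * ν (spanningSets ν k)) ^ (r / s) ∂μ := by
      rw [← lintegral_indicator (measurableSet_spanningSets μ k)]
      refine lintegral_mono fun t => ?_
      have h := ENNReal.rpow_le_rpow (hNle k t) (div_pos hr0 hs0).le
      refine h.trans ?_
      by_cases ht : t ∈ spanningSets μ k
      · simp [ht]
      · simp [ht, div_pos hr0 hs0]
    refine (this.trans_lt ?_).ne
    rw [setLIntegral_const]
    exact ENNReal.mul_lt_top (ENNReal.rpow_lt_top_of_nonneg (div_pos hr0 hs0).le (hKfin k))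
      (measure_spanningSets_lt_top μ k)
  have hbound : ∀ k, (∫⁻ t, N k t ^ (r / s) ∂μ) ^ (1 / r) ≤ C := by
    intro k
    set I := ∫⁻ t, N k t ^ (r / s) ∂μ with hIdef
    -- The extremal test function of the mixed norm. Its dual norm to the power `r'` and its pairing
    -- with `G k` both equal `I`. The exponent `e` may be negative, so `N k t = 0` is treated
    -- separately.
    let e : ℝ := (r - s) / s
    let g : T × X → ℝ≥0∞ := fun z => G k z ^ (s - 1) * N k z.1 ^ e
    have hgm : Measurable g :=
      ((hGm k).pow_const _).mul (((hNm k).comp measurable_fst).pow_const _)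
    have hlow : I ≤ ∫⁻ t, ∫⁻ x, F (t, x) * g (t, x) ∂ν ∂μ := by
      refine lintegral_mono fun t => ?_
      calc N k t ^ (r / s) ≤ N k t * N k t ^ e := by
            by_cases h0 : N k t = 0
            · simp [h0, div_pos hr0 hs0]
            · refine le_of_eq ?_
              have h1 : r / s = 1 + e := by simp only [e]; field_simp; ring
              rw [h1, ENNReal.rpow_add _ _ h0 (hNfin k t), ENNReal.rpow_one]
        _ = ∫⁻ x, G k (t, x) ^ s * N k t ^ e ∂ν := by
            have hm : Measurable fun x => G k (t, x) ^ s :=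
              ((hGm k).comp measurable_prodMk_left).pow_const s
            rw [lintegral_mul_const _ hm]
        _ ≤ ∫⁻ x, F (t, x) * g (t, x) ∂ν := by
            refine lintegral_mono fun x => ?_
            simp only [g]
            rw [← mul_assoc]
            gcongr
            have h1 : G k (t, x) ^ s = G k (t, x) * G k (t, x) ^ (s - 1) := by
              conv_rhs => rw [← ENNReal.rpow_one (G k (t, x)), ← ENNReal.rpow_mul, one_mul]
              rw [← ENNReal.rpow_add_of_nonneg _ _ zero_le_one hs1.le]
              congr 1; ring
            rw [h1]
            gcongr
            exact hGF k _
    have hup : ∫⁻ t, (∫⁻ x, g (t, x) ^ s' ∂ν) ^ (r' / s') ∂μ = I := by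
      refine lintegral_congr fun t => ?_
      have h1 : ∀ x, g (t, x) ^ s' = G k (t, x) ^ s * N k t ^ (e * s') := by
        intro x
        simp only [g]
        rw [ENNReal.mul_rpow_of_nonneg _ _ hs0'.le, ← ENNReal.rpow_mul, ← ENNReal.rpow_mul,
          hs.sub_one_mul_conj]
      simp only [h1]
      have hm : Measurable fun x => G k (t, x) ^ s :=
        ((hGm k).comp measurable_prodMk_left).pow_const s
      rw [lintegral_mul_const _ hm]
      change (N k t * N k t ^ (e * s')) ^ (r' / s') = N k t ^ (r / s)
      by_cases h0 : N k t = 0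
      · simp [h0, div_pos hr0 hs0, div_pos hr0' hs0']
      · conv_lhs => rw [← ENNReal.rpow_one (N k t), ← ENNReal.rpow_mul, one_mul]
        rw [← ENNReal.rpow_add _ _ h0 (hNfin k t), ← ENNReal.rpow_mul]
        congr 1
        have e1 : s + s' = s * s' := by
          have := hs.inv_add_inv_eq_one; field_simp at this; linarith
        have e2 : r + r' = r * r' := by
          have := hr.inv_add_inv_eq_one; field_simp at this; linarith
        simp only [e]
        field_simp
        have e3 : s + (r - s) * s' = s' * (r - 1) := by linear_combination e1
        have e4 : (r - 1) * r' = r := by linear_combination -e2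
        linear_combination r' * e3 + s' * e4
    have hmain := hlow.trans (H g hgm)
    rw [hup] at hmain
    by_cases hI0 : I = 0
    · rw [hI0, ENNReal.zero_rpow_of_pos (by positivity)]; exact bot_le
    have h1 : I ^ (1 / r) * I ^ (1 / r') = I := by
      rw [← ENNReal.rpow_add _ _ hI0 (hI k), one_div, one_div, hr.inv_add_inv_eq_one,
        ENNReal.rpow_one]
    have h2 : I ^ (1 / r) * I ^ (1 / r') ≤ C * I ^ (1 / r') := by rw [h1]; exact hmain
    refine (ENNReal.mul_le_mul_iff_left ?_ ?_).1 h2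
    · exact (ENNReal.rpow_pos (pos_iff_ne_zero.2 hI0) (hI k)).ne'
    · exact ENNReal.rpow_ne_top_of_nonneg (by positivity) (hI k)
  have hNmono : ∀ t, Monotone fun k => N k t := by
    intro t j k hjk
    refine lintegral_mono fun x => ?_
    exact ENNReal.rpow_le_rpow (hGmono _ hjk) hs0.le
  have hNlim : ∀ t, Filter.Tendsto (fun k => N k t) Filter.atTop
      (nhds (∫⁻ x, F (t, x) ^ s ∂ν)) := by
    intro t
    refine lintegral_tendsto_of_tendsto_of_monotone
      (fun k => (((hGm k).comp measurable_prodMk_left).pow_const s).aemeasurable)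
      (Filter.Eventually.of_forall fun x j k hjk => ENNReal.rpow_le_rpow (hGmono _ hjk) hs0.le)
      (Filter.Eventually.of_forall fun x => ?_)
    exact (ENNReal.continuous_rpow_const.tendsto _).comp (hGlim (t, x))
  have hlim : Filter.Tendsto (fun k => (∫⁻ t, N k t ^ (r / s) ∂μ) ^ (1 / r)) Filter.atTop
      (nhds ((∫⁻ t, (∫⁻ x, F (t, x) ^ s ∂ν) ^ (r / s) ∂μ) ^ (1 / r))) := by
    refine (ENNReal.continuous_rpow_const.tendsto _).comp ?_
    refine lintegral_tendsto_of_tendsto_of_monotone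
      (fun k => ((hNm k).pow_const (r / s)).aemeasurable)
      (Filter.Eventually.of_forall fun t j k hjk =>
        ENNReal.rpow_le_rpow (hNmono t hjk) (div_pos hr0 hs0).le)
      (Filter.Eventually.of_forall fun t => ?_)
    exact (ENNReal.continuous_rpow_const.tendsto _).comp (hNlim t)
  exact le_of_tendsto' hlim hbound

/-- The converse of Hölder's inequality. -/
theorem Lp_norm_le_of_forall_lintegral_mul_le {T : Type*} [MeasurableSpace T]
    (μ : Measure T) [SigmaFinite μ] {r r' : ℝ} (hr : r.HolderConjugate r')
    {F : T → ℝ≥0∞} (hF : Measurable F) {C : ℝ≥0∞}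
    (H : ∀ g : T → ℝ≥0∞, Measurable g → ∫⁻ t, F t * g t ∂μ ≤ C * (∫⁻ t, g t ^ r' ∂μ) ^ (1 / r')) :
    (∫⁻ t, F t ^ r ∂μ) ^ (1 / r) ≤ C := by
  -- The second factor is taken to be a one-point space.
  have h := mixed_norm_le_of_forall_lintegral_mul_le μ (Measure.dirac ()) hr hr
    (F := fun z => F z.1) (hF.comp measurable_fst) (C := C) (fun g hg => ?_)
  · simpa [lintegral_dirac, div_self hr.pos.ne'] using h
  · simpa [lintegral_dirac, div_self hr.symm.pos.ne'] using
      H (fun t => g (t, ())) (hg.comp measurable_prodMk_right)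

/-! ### The one-variable maximal function in mixed norms. -/

namespace CellFiltration

variable {T X : Type*} [MeasurableSpace T] [MeasurableSpace X] {μ : Measure T} {ν : Measure X}
  [SigmaFinite μ] [SigmaFinite ν] {ι : Type*} [MeasurableSpace ι]
  [DiscreteMeasurableSpace ι] [Countable ι] (𝒟 : CellFiltration T μ ι)

/-- The weights depend on `t` only and both integrals carry the same power `q`, so Tonelli's theorem
reduces the claim to the scalar inequality for each fixed `x`. -/
theorem WeightPair.strong_type_prod {q₀ q : ℝ} (hq₀ : 0 < q₀) (hq : q₀ < q) {W V : T → ℝ≥0∞}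
    (hW : Measurable W) (hV : Measurable V) (hWV : 𝒟.WeightPair q₀ W V)
    {h : T × X → ℝ≥0∞} (hh : Measurable h) :
    ∫⁻ t, (∫⁻ x, 𝒟.maximal (fun s => h (s, x)) t ^ q ∂ν) * W t ∂μ ≤
      ENNReal.ofReal (2 ^ q * q / (q - q₀)) * ∫⁻ t, (∫⁻ x, h (t, x) ^ q ∂ν) * V t ∂μ := by
  have hM := 𝒟.measurable_maximal_prod hh
  have hswap : ∀ (F : T × X → ℝ≥0∞) (U : T → ℝ≥0∞), Measurable F → Measurable U →
      ∫⁻ t, (∫⁻ x, F (t, x) ^ q ∂ν) * U t ∂μ = ∫⁻ x, ∫⁻ t, F (t, x) ^ q * U t ∂μ ∂ν := by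
    intro F U hF hU
    have h1 : ∀ t, (∫⁻ x, F (t, x) ^ q ∂ν) * U t = ∫⁻ x, F (t, x) ^ q * U t ∂ν := by
      intro t
      rw [lintegral_mul_const]
      exact (hF.comp measurable_prodMk_left).pow_const q
    simp only [h1]
    rw [lintegral_lintegral_swap]
    exact ((hF.pow_const q).mul (hU.comp measurable_fst)).aemeasurable
  rw [hswap _ W hM hW, hswap _ V hh hV, ← lintegral_const_mul' _ _ ENNReal.ofReal_ne_top]
  refine lintegral_mono fun x => ?_
  exact hWV.strong_type hq₀ hq hW hV (hh.comp measurable_prodMk_right)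

/-- Here `m = p / q > 1`, so the outer norm can be computed by pairing with `φ` in `L_{m'}`. The
weight pair `φ`, `Mφ` carries the maximal function over to `φ`, where it is bounded in `L_{m'}`. -/
theorem maximal_mixed_of_gt {p q : ℝ} (hq : 1 < q) (hpq : q < p) :
    ∃ C : ℝ≥0, ∀ (𝒟 : CellFiltration T μ ι) (h : T × X → ℝ≥0∞), Measurable h →
      ∫⁻ t, (∫⁻ x, 𝒟.maximal (fun s => h (s, x)) t ^ q ∂ν) ^ (p / q) ∂μ ≤
        C * ∫⁻ t, (∫⁻ x, h (t, x) ^ q ∂ν) ^ (p / q) ∂μ := by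
  have hq0 : 0 < q := by linarith
  set m := p / q with hm
  have hm1 : 1 < m := by rw [hm, one_lt_div hq0]; exact hpq
  have hm0 : 0 < m := by linarith
  obtain ⟨m', hconj⟩ : ∃ m', m.HolderConjugate m' := ⟨_, Real.HolderConjugate.conjExponent hm1⟩
  have hm1' := hconj.symm.lt
  have hm0' := hconj.symm.pos
  set C₁ := ENNReal.ofReal (2 ^ q * q / (q - 1)) with hC₁
  set C₂ := ENNReal.ofReal (2 ^ m' * m' / (m' - 1)) with hC₂
  have hCfin : (C₁ * C₂ ^ (1 / m')) ^ m ≠ ∞ := ENNReal.rpow_ne_top_of_nonneg hm0.le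
    (ENNReal.mul_ne_top ENNReal.ofReal_ne_top
      (ENNReal.rpow_ne_top_of_nonneg (by positivity) ENNReal.ofReal_ne_top))
  refine ⟨((C₁ * C₂ ^ (1 / m')) ^ m).toNNReal, fun 𝒟 h hh => ?_⟩
  rw [ENNReal.coe_toNNReal hCfin]
  set G : T → ℝ≥0∞ := fun t => ∫⁻ x, h (t, x) ^ q ∂ν with hG
  have hGm : Measurable G := (hh.pow_const q).lintegral_prod_right'
  have hHm : Measurable fun t => ∫⁻ x, 𝒟.maximal (fun s => h (s, x)) t ^ q ∂ν :=
    ((𝒟.measurable_maximal_prod hh).pow_const q).lintegral_prod_right'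
  have key := Lp_norm_le_of_forall_lintegral_mul_le μ hconj hHm
    (C := C₁ * C₂ ^ (1 / m') * (∫⁻ t, G t ^ m ∂μ) ^ (1 / m)) (fun φ hφ => ?_)
  · have h1 := ENNReal.rpow_le_rpow key hm0.le
    rw [← ENNReal.rpow_mul, one_div_mul_cancel hm0.ne', ENNReal.rpow_one,
      ENNReal.mul_rpow_of_nonneg _ _ hm0.le, ← ENNReal.rpow_mul, one_div_mul_cancel hm0.ne',
      ENNReal.rpow_one] at h1
    exact h1
  · calc _ ≤ C₁ * ∫⁻ t, G t * 𝒟.maximal φ t ∂μ :=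
          (weightPair_maximal hφ).strong_type_prod 𝒟 one_pos hq hφ (𝒟.measurable_maximal φ) hh
      _ ≤ C₁ * ((∫⁻ t, G t ^ m ∂μ) ^ (1 / m) * (∫⁻ t, 𝒟.maximal φ t ^ m' ∂μ) ^ (1 / m')) := by
          gcongr
          exact ENNReal.lintegral_mul_le_Lp_mul_Lq μ hconj hGm.aemeasurable
            (𝒟.measurable_maximal φ).aemeasurable
      _ ≤ C₁ * ((∫⁻ t, G t ^ m ∂μ) ^ (1 / m) * (C₂ * ∫⁻ t, φ t ^ m' ∂μ) ^ (1 / m')) := by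
          gcongr
          exact lintegral_maximal_rpow_le hm1' hφ
      _ = _ := by
          rw [ENNReal.mul_rpow_of_nonneg _ _ (by positivity)]; ring

/-- Here `m = p / q < 1` and pairing is not available. With `n` a majorant of the inner norm of `h`,
set `u = n ^ a`. The pair `(Mu)^{1-q₀}`, `u^{1-q₀}` bounds the integral of `Hf * (Mu)^{1-q₀}` by
that of `n ^ p`. Hölder's inequality with exponents `m` and `1 - m` removes the weight at the cost
of the integral of `(Mu)^e`, and this too is bounded by that of `n ^ p`. -/
theorem maximal_mixed_of_lt {p q : ℝ} (hp : 1 < p) (hpq : p < q) :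
    ∃ C : ℝ≥0, ∀ (𝒟 : CellFiltration T μ ι) (h : T × X → ℝ≥0∞), Measurable h →
      ∫⁻ t, (∫⁻ x, 𝒟.maximal (fun s => h (s, x)) t ^ q ∂ν) ^ (p / q) ∂μ ≤
        C * ∫⁻ t, (∫⁻ x, h (t, x) ^ q ∂ν) ^ (p / q) ∂μ := by
  have hp0 : 0 < p := by linarith
  have hq0 : 0 < q := by linarith
  have hqp : 0 < q - p := by linarith
  set m := p / q with hm
  have hm1 : m < 1 := by rw [hm, div_lt_one hq0]; exact hpq
  have hm0 : 0 < m := by positivity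
  -- The bound `q₀ < q` is needed for the strong type at `q`, and `q / p < q₀` is equivalent to `e >
  -- 1`, the range in which `Mu` is bounded in `L_e`. The value of `a` makes `n ^ q * u ^ (1 - q₀)`
  -- equal to `n ^ p`.
  obtain ⟨q₀, h1, h2⟩ : ∃ q₀, q / p < q₀ ∧ q₀ < q :=
    exists_between (div_lt_self hq0 hp)
  have hq₀1 : 1 < q₀ := lt_trans ((one_lt_div hp0).2 hpq) h1
  have hq₀0 : 0 < q₀ := by linarith
  have hq₀' : 0 < q₀ - 1 := by linarith
  set a := (q - p) / (q₀ - 1) with ha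
  have ha0 : 0 < a := div_pos hqp hq₀'
  set e := p / a with he
  have he1 : 1 < e := by
    rw [he, one_lt_div ha0, ha, div_lt_iff₀ hq₀']
    have := (div_lt_iff₀ hp0).1 h1
    nlinarith
  set C₁ := ENNReal.ofReal (2 ^ q * q / (q - q₀)) with hC₁
  set C₂ := ENNReal.ofReal (2 ^ e * e / (e - 1)) with hC₂
  have hCfin : C₁ ^ m * C₂ ^ (1 - m) ≠ ∞ :=
    ENNReal.mul_ne_top (ENNReal.rpow_ne_top_of_nonneg hm0.le ENNReal.ofReal_ne_top)
      (ENNReal.rpow_ne_top_of_nonneg (by linarith) ENNReal.ofReal_ne_top)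
  refine ⟨(C₁ ^ m * C₂ ^ (1 - m)).toNNReal, fun 𝒟 h hh => ?_⟩
  rw [ENNReal.coe_toNNReal hCfin]
  set G : T → ℝ≥0∞ := fun t => ∫⁻ x, h (t, x) ^ q ∂ν with hG
  have hGm : Measurable G := (hh.pow_const q).lintegral_prod_right'
  set Hf : T → ℝ≥0∞ := fun t => ∫⁻ x, 𝒟.maximal (fun s => h (s, x)) t ^ q ∂ν with hHf
  have hHm : Measurable Hf :=
    ((𝒟.measurable_maximal_prod hh).pow_const q).lintegral_prod_right'
  by_cases hfin : ∫⁻ t, G t ^ m ∂μ = ∞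
  · rw [hfin]
    -- The constant must be positive for its product with an infinite right-hand side to be
    -- infinite.
    by_cases hC : C₁ ^ m * C₂ ^ (1 - m) = 0
    · have hC1 : C₁ ≠ 0 := (ENNReal.ofReal_pos.2 (div_pos (by positivity) (by linarith))).ne'
      have hC2 : C₂ ≠ 0 := (ENNReal.ofReal_pos.2 (div_pos (by positivity) (by linarith))).ne'
      rcases mul_eq_zero.1 hC with h | h
      · exact absurd h (ENNReal.rpow_pos (pos_iff_ne_zero.2 hC1) ENNReal.ofReal_ne_top).ne'
      · exact absurd h (ENNReal.rpow_pos (pos_iff_ne_zero.2 hC2) ENNReal.ofReal_ne_top).ne'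
    · rw [ENNReal.mul_top hC]; exact le_top
  -- the estimate with the inner norm replaced by a positive finite majorant `n`
  have main : ∀ n : T → ℝ≥0∞, Measurable n → (∀ t, n t ≠ 0) → (∀ t, n t ≠ ∞) →
      (∀ᵐ t ∂μ, G t ≤ n t ^ q) → ∫⁻ t, n t ^ p ∂μ ≠ ∞ →
      ∫⁻ t, Hf t ^ m ∂μ ≤ C₁ ^ m * C₂ ^ (1 - m) * ∫⁻ t, n t ^ p ∂μ := by
    intro n hnm hn0 hnt hGn hnI
    set u : T → ℝ≥0∞ := fun t => n t ^ a with hu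
    have hum : Measurable u := hnm.pow_const a
    have hu0 : ∀ t, u t ≠ 0 := fun t => (ENNReal.rpow_pos (pos_iff_ne_zero.2 (hn0 t)) (hnt t)).ne'
    have hut : ∀ t, u t ≠ ∞ := fun t => ENNReal.rpow_ne_top_of_nonneg ha0.le (hnt t)
    have hMm := 𝒟.measurable_maximal u
    -- Each cell has positive measure and `u` is positive, so already the average of level 0 is
    -- nonzero.
    have hM0 : ∀ t, 𝒟.maximal u t ≠ 0 := by
      intro t h0
      have h1 : 𝒟.avg 0 u t = 0 := le_antisymm (h0 ▸ 𝒟.avg_le_maximal 0 u t) bot_le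
      have h2 : ∫⁻ y in 𝒟.cell 0 t, u y ∂μ = 0 := by
        rcases mul_eq_zero.1 h1 with h | h
        · exact absurd h (ENNReal.inv_ne_zero.2 (𝒟.measure_ne_top 0 t))
        · exact h
      rw [lintegral_eq_zero_iff hum] at h2
      have h3 : μ.restrict (𝒟.cell 0 t) = 0 := by
        rw [← ae_eq_bot, Filter.eventually_false_iff_eq_bot.symm]
        filter_upwards [h2] with y hy using hu0 y hy
      exact 𝒟.measure_ne_zero 0 t (Measure.restrict_eq_zero.1 h3)
    have hue : ∀ t, u t ^ e = n t ^ p := by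
      intro t
      simp only [hu, he]
      rw [← ENNReal.rpow_mul, mul_div_cancel₀ _ ha0.ne']
    have hMe : ∫⁻ t, 𝒟.maximal u t ^ e ∂μ ≤ C₂ * ∫⁻ t, n t ^ p ∂μ := by
      simpa only [hue] using lintegral_maximal_rpow_le (𝒟 := 𝒟) he1 hum
    have hMt : ∀ᵐ t ∂μ, 𝒟.maximal u t ≠ ∞ := by
      have h1 := ae_lt_top (hMm.pow_const e)
        (hMe.trans_lt (ENNReal.mul_lt_top ENNReal.ofReal_lt_top hnI.lt_top)).ne
      filter_upwards [h1] with t ht htop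
      rw [htop, ENNReal.top_rpow_of_pos (by linarith)] at ht
      exact lt_irrefl _ ht
    have hstr := (weightPair_rpow (𝒟 := 𝒟) hq₀1 hum hu0 hut).strong_type_prod 𝒟 hq₀0 h2
      (hMm.pow_const (1 - q₀)) (hum.pow_const (1 - q₀)) hh (ν := ν)
    have hV : ∫⁻ t, G t * u t ^ (1 - q₀) ∂μ ≤ ∫⁻ t, n t ^ p ∂μ := by
      refine lintegral_mono_ae ?_
      filter_upwards [hGn] with t ht
      calc G t * u t ^ (1 - q₀) ≤ n t ^ q * u t ^ (1 - q₀) := by gcongr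
        _ = n t ^ p := by
          simp only [hu]
          rw [← ENNReal.rpow_mul, ← ENNReal.rpow_add _ _ (hn0 t) (hnt t)]
          congr 1
          have : a * (1 - q₀) = -(q - p) := by rw [ha]; field_simp; ring
          rw [this]; ring
    calc ∫⁻ t, Hf t ^ m ∂μ
        ≤ ∫⁻ t, (Hf t * 𝒟.maximal u t ^ (1 - q₀)) ^ m * (𝒟.maximal u t ^ e) ^ (1 - m) ∂μ := by
          refine lintegral_mono_ae ?_
          filter_upwards [hMt] with t ht
          refine le_of_eq ?_
          rw [ENNReal.mul_rpow_of_nonneg _ _ hm0.le, ← ENNReal.rpow_mul, ← ENNReal.rpow_mul,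
            mul_assoc, ← ENNReal.rpow_add _ _ (hM0 t) ht]
          have : (1 - q₀) * m + e * (1 - m) = 0 := by
            rw [he, ha, hm]; field_simp; ring
          rw [this, ENNReal.rpow_zero, mul_one]
      _ ≤ (∫⁻ t, Hf t * 𝒟.maximal u t ^ (1 - q₀) ∂μ) ^ m *
            (∫⁻ t, 𝒟.maximal u t ^ e ∂μ) ^ (1 - m) := by
          have hm' : Measurable fun t => Hf t * 𝒟.maximal u t ^ (1 - q₀) :=
            hHm.mul (hMm.pow_const _)
          exact ENNReal.lintegral_mul_norm_pow_le hm'.aemeasurable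
            (hMm.pow_const e).aemeasurable hm0.le (by linarith) (by ring)
      _ ≤ (C₁ * ∫⁻ t, n t ^ p ∂μ) ^ m * (C₂ * ∫⁻ t, n t ^ p ∂μ) ^ (1 - m) := by
          have : 0 ≤ 1 - m := by linarith
          gcongr
          exact hstr.trans (mul_le_mul' le_rfl hV)
      _ = C₁ ^ m * C₂ ^ (1 - m) *
          ((∫⁻ t, n t ^ p ∂μ) ^ m * (∫⁻ t, n t ^ p ∂μ) ^ (1 - m)) := by
          rw [ENNReal.mul_rpow_of_nonneg _ _ hm0.le,
            ENNReal.mul_rpow_of_nonneg _ _ (by linarith : 0 ≤ 1 - m)]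
          ring
      _ = _ := by
          rw [← ENNReal.rpow_add_of_nonneg _ _ hm0.le (by linarith)]
          simp
  have hGfin : ∀ᵐ t ∂μ, G t ≠ ∞ := by
    filter_upwards [ae_lt_top (hGm.pow_const m) hfin] with t ht htop
    rw [htop, ENNReal.top_rpow_of_pos hm0] at ht
    exact lt_irrefl _ ht
  refine ENNReal.le_of_forall_pos_le_add fun ε hε _ => ?_
  -- The inner norm may vanish, so a positive function of small integral is added to its `p`-th
  -- power; the resulting error, multiplied by the constant, is at most `ε`.
  obtain ⟨w, hw0, hwm, hwI⟩ := exists_pos_lintegral_lt_of_sigmaFinite μ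
    (ε := ε / (C₁ ^ m * C₂ ^ (1 - m))) (ENNReal.div_pos (by simpa using hε.ne') hCfin).ne'
  let n : T → ℝ≥0∞ := fun t => if G t = ∞ then 1 else (G t ^ m + w t) ^ (1 / p)
  have hnm : Measurable n := by
    refine Measurable.ite (hGm (measurableSet_singleton ∞)) measurable_const ?_
    exact ((hGm.pow_const m).add hwm.coe_nnreal_ennreal).pow_const _
  have hsumt : ∀ t, G t ≠ ∞ → G t ^ m + w t ≠ ∞ := fun t ht =>
    ENNReal.add_ne_top.2 ⟨ENNReal.rpow_ne_top_of_nonneg hm0.le ht, ENNReal.coe_ne_top⟩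
  have hsum0 : ∀ t, G t ^ m + w t ≠ 0 := by
    intro t h0
    exact (hw0 t).ne' (by simpa using (add_eq_zero.1 h0).2)
  have hnp : ∀ᵐ t ∂μ, n t ^ p = G t ^ m + w t := by
    filter_upwards [hGfin] with t ht
    simp only [n, ht, if_false]
    rw [← ENNReal.rpow_mul, one_div_mul_cancel hp0.ne', ENNReal.rpow_one]
  have hnI : ∫⁻ t, n t ^ p ∂μ = ∫⁻ t, G t ^ m ∂μ + ∫⁻ t, w t ∂μ := by
    rw [lintegral_congr_ae hnp, lintegral_add_left (hGm.pow_const m)]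
  have hmain := main n hnm ?_ ?_ ?_ ?_
  · refine hmain.trans ?_
    rw [hnI, mul_add]
    gcongr
    exact (mul_le_mul' le_rfl hwI.le).trans ENNReal.mul_div_le
  · intro t
    by_cases ht : G t = ∞
    · simp [n, ht]
    · simp only [n, ht, if_false]
      exact (ENNReal.rpow_pos (pos_iff_ne_zero.2 (hsum0 t)) (hsumt t ht)).ne'
  · intro t
    by_cases ht : G t = ∞
    · simp [n, ht]
    · simp only [n, ht, if_false]
      exact ENNReal.rpow_ne_top_of_nonneg (by positivity) (hsumt t ht)
  · filter_upwards [hGfin] with t ht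
    simp only [n, ht, if_false]
    rw [← ENNReal.rpow_mul]
    calc G t = (G t ^ m) ^ (1 / p * q) := by
          rw [← ENNReal.rpow_mul, hm]
          have : p / q * (1 / p * q) = 1 := by field_simp
          rw [this, ENNReal.rpow_one]
      _ ≤ _ := by gcongr; exact le_self_add
  · rw [hnI]
    refine ENNReal.add_ne_top.2 ⟨hfin, (hwI.trans_le le_top).ne⟩

/-- The maximal function in one variable is bounded in mixed norm spaces. -/
theorem maximal_mixed {p q : ℝ} (hp : 1 < p) (hq : 1 < q) :
    ∃ C : ℝ≥0, ∀ (𝒟 : CellFiltration T μ ι) (h : T × X → ℝ≥0∞), Measurable h →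
      ∫⁻ t, (∫⁻ x, 𝒟.maximal (fun s => h (s, x)) t ^ q ∂ν) ^ (p / q) ∂μ ≤
        C * ∫⁻ t, (∫⁻ x, h (t, x) ^ q ∂ν) ^ (p / q) ∂μ := by
  rcases lt_trichotomy p q with h | h | h
  · exact maximal_mixed_of_lt hp h
  · subst h
    refine ⟨(2 ^ p * p / (p - 1)).toNNReal, fun 𝒟 h hh => ?_⟩
    have h1 := (weightPair_one (𝒟 := 𝒟)).strong_type_prod 𝒟 one_pos hp measurable_const
      measurable_const hh (ν := ν)
    simp only [mul_one] at h1
    simp only [div_self (by linarith : p ≠ 0), ENNReal.rpow_one]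
    exact h1
  · exact maximal_mixed_of_gt hq h

end CellFiltration

/-! ### Geometric sums and a Carleson embedding. -/

theorem summable_pow_natAbs {r : ℝ} (hr0 : 0 ≤ r) (hr1 : r < 1) :
    Summable fun i : ℤ => r ^ i.natAbs := by
  refine Summable.of_nat_of_neg ?_ ?_
  · simpa using summable_geometric_of_lt_one hr0 hr1
  · simpa using summable_geometric_of_lt_one hr0 hr1

/-- A geometric sequence is dominated by its maximum with a higher power, with a summable gain. -/
theorem exists_geometric_le {τ γ : ℝ} (hτ0 : 0 < τ) (hτ1 : τ < 1) (hγ : 1 < γ) :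
    ∃ (K r : ℝ), 0 ≤ K ∧ 0 ≤ r ∧ r < 1 ∧ ∀ c : ℝ, 0 ≤ c → ∃ n : ℤ, ∀ k : ℕ,
      c * τ ^ k ≤ K * r ^ (n - k).natAbs * max 1 ((c * τ ^ k) ^ γ) := by
  -- Write `c * τ ^ k = τ ^ y` with `y = k - u`. If `y ≥ 0` it is compared with 1, if `y ≤ 0` with
  -- its `γ`-th power; the gain is `τ ^ |y|` or `τ ^ ((γ - 1) |y|)`, in both cases at most `τ ^ (δ
  -- |y|)`.
  set δ := min 1 (γ - 1) with hδ
  have hδ0 : 0 < δ := lt_min one_pos (by linarith)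
  refine ⟨τ ^ (-δ), τ ^ δ, by positivity, by positivity, Real.rpow_lt_one hτ0.le hτ1 hδ0,
    fun c hc => ?_⟩
  rcases hc.eq_or_lt with rfl | hc
  · refine ⟨0, fun k => ?_⟩
    rw [zero_mul]; positivity
  set u := -Real.logb τ c with hu
  have hcu : c = τ ^ (-u) := by
    rw [hu, neg_neg, Real.rpow_logb hτ0 hτ1.ne hc]
  -- Rounding `u` to an integer changes the distance by at most 1, which costs the factor `τ ^
  -- (-δ)`.
  refine ⟨⌊u⌋, fun k => ?_⟩
  have hck : c * τ ^ k = τ ^ ((k : ℝ) - u) := by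
    rw [hcu, ← Real.rpow_natCast, ← Real.rpow_add hτ0]; congr 1; ring
  have habs : |(k : ℝ) - u| ≥ ((⌊u⌋ - k).natAbs : ℝ) - 1 := by
    have h1 : ((⌊u⌋ - (k : ℤ)).natAbs : ℝ) = |(⌊u⌋ : ℝ) - k| := by
      rw [Nat.cast_natAbs]; push_cast; rfl
    rw [h1]
    have h2 := Int.floor_le u
    have h3 := Int.lt_floor_add_one u
    have h4 : |(⌊u⌋ : ℝ) - k| ≤ |(⌊u⌋ : ℝ) - u| + |u - k| := abs_sub_le _ _ _
    have h5 : |(⌊u⌋ : ℝ) - u| ≤ 1 := by rw [abs_le]; constructor <;> linarith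
    rw [abs_sub_comm (k : ℝ) u]; linarith
  have hKr : τ ^ (δ * |(k : ℝ) - u|) ≤ τ ^ (-δ) * (τ ^ δ) ^ (⌊u⌋ - k).natAbs := by
    rw [← Real.rpow_natCast, ← Real.rpow_mul hτ0.le, ← Real.rpow_add hτ0]
    refine Real.rpow_le_rpow_of_exponent_ge hτ0 hτ1.le ?_
    nlinarith
  refine le_trans ?_ (mul_le_mul_of_nonneg_right hKr (by positivity))
  rw [hck, ← Real.rpow_mul hτ0.le]
  rcases le_total 0 ((k : ℝ) - u) with h | h
  · rw [abs_of_nonneg h]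
    refine le_trans ?_ (le_mul_of_one_le_right (by positivity) (le_max_left _ _))
    refine Real.rpow_le_rpow_of_exponent_ge hτ0 hτ1.le ?_
    have : δ ≤ 1 := min_le_left _ _
    nlinarith
  · rw [abs_of_nonpos h]
    refine le_trans ?_ (mul_le_mul_of_nonneg_left (le_max_right _ _) (by positivity))
    rw [← Real.rpow_add hτ0]
    refine Real.rpow_le_rpow_of_exponent_ge hτ0 hτ1.le ?_
    have : δ ≤ γ - 1 := min_le_right _ _
    nlinarith

/-- Each term is at most the supremum times a factor decaying geometrically away from the index
where `c * τ ^ k` crosses 1. The sum of these factors does not depend on `c`, which matters because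
`c` will vary with the point. -/
theorem exists_tsum_geometric_mul_le {τ : ℝ≥0} {γ : ℝ} (hτ0 : 0 < τ) (hτ1 : τ < 1) (hγ : 1 < γ) :
    ∃ K : ℝ≥0, ∀ (c : ℝ≥0) (a : ℕ → ℝ≥0∞),
      ∑' k, ((c * τ ^ k : ℝ≥0) : ℝ≥0∞) * a k ≤
        K * ⨆ k, max 1 (((c * τ ^ k : ℝ≥0) : ℝ≥0∞) ^ γ) * a k := by
  obtain ⟨K, r, hK, hr0, hr1, H⟩ := exists_geometric_le (τ := (τ : ℝ)) (by exact_mod_cast hτ0)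
    (by exact_mod_cast hτ1) hγ
  lift K to ℝ≥0 using hK
  lift r to ℝ≥0 using hr0
  have hsum : ∑' i : ℤ, ((r ^ i.natAbs : ℝ≥0) : ℝ≥0∞) ≠ ∞ := by
    rw [ENNReal.tsum_coe_ne_top_iff_summable, ← NNReal.summable_coe]
    simpa using summable_pow_natAbs (NNReal.coe_nonneg r) hr1
  refine ⟨K * (∑' i : ℤ, ((r ^ i.natAbs : ℝ≥0) : ℝ≥0∞)).toNNReal, fun c a => ?_⟩
  obtain ⟨n, hn⟩ := H c c.2
  have hn' : ∀ k : ℕ, ((c * τ ^ k : ℝ≥0) : ℝ≥0∞) ≤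
      K * ((r ^ (n - k).natAbs : ℝ≥0) : ℝ≥0∞) * max 1 (((c * τ ^ k : ℝ≥0) : ℝ≥0∞) ^ γ) := by
    intro k
    rw [← ENNReal.coe_rpow_of_nonneg _ (by linarith), ← ENNReal.coe_one, ← ENNReal.coe_max,
      ← ENNReal.coe_mul, ← ENNReal.coe_mul, ENNReal.coe_le_coe, ← NNReal.coe_le_coe]
    have := hn k
    push_cast
    exact this
  set A := ⨆ k, max 1 (((c * τ ^ k : ℝ≥0) : ℝ≥0∞) ^ γ) * a k with hA
  calc ∑' k, ((c * τ ^ k : ℝ≥0) : ℝ≥0∞) * a k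
      ≤ ∑' k : ℕ, K * (((r ^ (n - k).natAbs : ℝ≥0) : ℝ≥0∞) * A) := by
        refine ENNReal.tsum_le_tsum fun k => ?_
        refine (mul_le_mul' (hn' k) le_rfl).trans ?_
        rw [mul_assoc, mul_assoc]
        gcongr
        exact le_iSup (fun k => max 1 (((c * τ ^ k : ℝ≥0) : ℝ≥0∞) ^ γ) * a k) k
    _ = K * (∑' k : ℕ, ((r ^ (n - k).natAbs : ℝ≥0) : ℝ≥0∞)) * A := by
        rw [ENNReal.tsum_mul_left, ENNReal.tsum_mul_right, mul_assoc]
    _ ≤ K * (∑' i : ℤ, ((r ^ i.natAbs : ℝ≥0) : ℝ≥0∞)) * A := by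
        gcongr
        have hinj : Function.Injective fun k : ℕ => n - (k : ℤ) := by
          intro i j hij
          simp only at hij
          omega
        exact ENNReal.tsum_comp_le_tsum_of_injective hinj
          fun i : ℤ => ((r ^ i.natAbs : ℝ≥0) : ℝ≥0∞)
    _ = _ := by rw [ENNReal.coe_mul, ENNReal.coe_toNNReal hsum]

/-- All contributing indices are at least `i`, so the sum is at most a geometric tail. -/
theorem tsum_ite_geometric_le (w A : ℝ≥0∞) {b : ℕ → ℝ≥0∞} {l : ℝ≥0∞} {i : ℕ}
    (h : ∀ j < i, ¬ l < b j) :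
    ∑' k, (if l < b k then A * w ^ k else 0) ≤ (1 - w)⁻¹ * (A * w ^ i) := by
  have hsplit := ENNReal.summable.sum_add_tsum_nat_add' (k := i)
    (f := fun k => if l < b k then A * w ^ k else 0)
  rw [← hsplit, Finset.sum_eq_zero, zero_add]
  · calc ∑' k, (if l < b (k + i) then A * w ^ (k + i) else 0) ≤ ∑' k, A * w ^ i * w ^ k := by
          refine ENNReal.tsum_le_tsum fun k => ?_
          split_ifs
          · rw [pow_add]; exact le_of_eq (by ring)
          · exact bot_le
      _ = _ := by rw [ENNReal.tsum_mul_left, ENNReal.tsum_geometric, mul_comm]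
  · intro j hj
    exact if_neg (h j (Finset.mem_range.1 hj))

namespace CellFiltration

variable {X : Type*} [MeasurableSpace X] {μ : Measure X} {ι : Type*} [MeasurableSpace ι]
  [DiscreteMeasurableSpace ι] [Countable ι] {𝒟 : CellFiltration X μ ι}

/-- Over a union of cells `F` and its cell averages have the same integral, and the averages are at
most `D`. -/
theorem setLIntegral_le_mul_measure [SFinite μ] {k : ℕ} {E : Set X} (hE : 𝒟.Invariant k E)
    {F : X → ℝ≥0∞} (hF : Measurable F) {D : ℝ≥0∞}
    (h : ∀ x, ∫⁻ y in 𝒟.cell k x, F y ∂μ ≤ D * μ (𝒟.cell k x)) :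
    ∫⁻ x in E, F x ∂μ ≤ D * μ E := by
  have h1 : ∫⁻ x in E, F x ∂μ = ∫⁻ x in E, 𝒟.avg k F x ∂μ := by
    have := 𝒟.setLIntegral_avg_mul hE hF (measurable_const (a := (1 : ℝ≥0∞)))
    simpa [𝒟.avg_const] using this.symm
  rw [h1, ← setLIntegral_const]
  refine lintegral_mono fun x => ?_
  unfold avg
  rw [mul_comm]
  exact (ENNReal.div_le_iff_le_mul (Or.inl (𝒟.measure_ne_zero k x))
    (Or.inl (𝒟.measure_ne_top k x))).2 (h x)

/-- A Carleson embedding: weights that are geometric in the scale and have bounded means over the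
cells of their scale. -/
theorem lintegral_tsum_mul_rpow_le [SFinite μ] {w : ℝ≥0} (hw : w < 1) {q : ℝ} (hq : 0 < q)
    {D : ℝ≥0} {F : X → ℝ≥0∞} (hF : Measurable F) {a : ℕ → X → ℝ≥0∞}
    (ham : ∀ k, Measurable (a k)) (ha : ∀ k x y, 𝒟.idx k x = 𝒟.idx k y → a k x = a k y)
    (hFD : ∀ k x, ∫⁻ y in 𝒟.cell k x, F y * (w : ℝ≥0∞) ^ k ∂μ ≤ D * μ (𝒟.cell k x)) :
    ∫⁻ x, ∑' k, F x * (w : ℝ≥0∞) ^ k * a k x ^ q ∂μ ≤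
      (1 - (w : ℝ≥0∞))⁻¹ * D * ∫⁻ x, (⨆ k, a k x) ^ q ∂μ := by
  have hFm : ∀ k, Measurable fun x => F x * (w : ℝ≥0∞) ^ k := fun k => hF.mul_const _
  have hKt : (1 - (w : ℝ≥0∞))⁻¹ ≠ ∞ := by
    rw [ENNReal.inv_ne_top, Ne, tsub_eq_zero_iff_le, not_le]
    exact_mod_cast hw
  have hlevel : ∀ l : ℝ≥0∞, ∑' k, ∫⁻ x in {x | l < a k x}, F x * (w : ℝ≥0∞) ^ k ∂μ ≤
      (1 - (w : ℝ≥0∞))⁻¹ * D * μ {x | l < ⨆ k, a k x} := by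
    intro l
    set E := firstHit a l with hEdef
    have hE := fun k => 𝒟.invariant_firstHit ha l k
    have hEm := fun k => Invariant.measurableSet 𝒟 (hE k)
    have hd : Pairwise (Function.onFun Disjoint E) := disjoint_disjointed _
    -- At a point first hit at index `i` the whole sum over scales collapses to its term at `i`, and
    -- the means of that term over cells of level `i` are bounded by hypothesis.
    have hpt : ∀ x, ∑' k, (if l < a k x then F x * (w : ℝ≥0∞) ^ k else 0) ≤
        ∑' i, (E i).indicator (fun x => (1 - (w : ℝ≥0∞))⁻¹ * (F x * (w : ℝ≥0∞) ^ i)) x := by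
      intro x
      by_cases hx : x ∈ ⋃ k, E k
      · obtain ⟨i, hi⟩ := Set.mem_iUnion.1 hx
        refine le_trans ?_ (ENNReal.le_tsum i)
        rw [Set.indicator_of_mem hi]
        exact tsum_ite_geometric_le w (F x) ((mem_firstHit_iff a l i x).1 hi).2
      · refine le_of_eq_of_le ?_ bot_le
        refine ENNReal.tsum_eq_zero.2 fun k => if_neg fun hk => hx ?_
        rw [iUnion_firstHit]
        exact lt_of_lt_of_le hk (le_iSup (fun k => a k x) k)
    calc ∑' k, ∫⁻ x in {x | l < a k x}, F x * (w : ℝ≥0∞) ^ k ∂μ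
        = ∫⁻ x, ∑' k, (if l < a k x then F x * (w : ℝ≥0∞) ^ k else 0) ∂μ := by
          rw [lintegral_tsum]
          · refine tsum_congr fun k => ?_
            rw [← lintegral_indicator (measurableSet_lt measurable_const (ham k))]
            refine lintegral_congr fun x => ?_
            by_cases h : l < a k x <;> simp [h]
          · exact fun k => (Measurable.ite (measurableSet_lt measurable_const (ham k)) (hFm k)
              measurable_const).aemeasurable
      _ ≤ ∫⁻ x, ∑' i, (E i).indicator (fun x => (1 - (w : ℝ≥0∞))⁻¹ * (F x * (w : ℝ≥0∞) ^ i)) x ∂μ :=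
          lintegral_mono hpt
      _ = ∑' i, (1 - (w : ℝ≥0∞))⁻¹ * ∫⁻ x in E i, F x * (w : ℝ≥0∞) ^ i ∂μ := by
          rw [lintegral_tsum]
          · refine tsum_congr fun k => ?_
            rw [lintegral_indicator (hEm k), lintegral_const_mul _ (hFm k)]
          · exact fun k => (((hFm k).const_mul _).indicator (hEm k)).aemeasurable
      _ ≤ ∑' i, (1 - (w : ℝ≥0∞))⁻¹ * (D * μ (E i)) := by
          refine ENNReal.tsum_le_tsum fun i => ?_
          gcongr
          exact setLIntegral_le_mul_measure (hE i) (hFm i) (hFD i)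
      _ = _ := by
          rw [ENNReal.tsum_mul_left, ENNReal.tsum_mul_left, ← measure_iUnion hd hEm,
            iUnion_firstHit, mul_assoc]
  have hanti : ∀ k, Antitone fun t : ℝ =>
      ∫⁻ x in {x | ENNReal.ofReal t < a k x}, F x * (w : ℝ≥0∞) ^ k ∂μ := by
    intro k s t hst
    refine lintegral_mono_set fun x hx => ?_
    exact lt_of_le_of_lt (ENNReal.ofReal_le_ofReal hst) hx
  calc ∫⁻ x, ∑' k, F x * (w : ℝ≥0∞) ^ k * a k x ^ q ∂μ
      = ∑' k, ∫⁻ x, F x * (w : ℝ≥0∞) ^ k * a k x ^ q ∂μ :=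
        lintegral_tsum fun k => ((hFm k).mul ((ham k).pow_const q)).aemeasurable
    _ = ∑' k, ∫⁻ t in Set.Ioi (0 : ℝ), ENNReal.ofReal (q * t ^ (q - 1)) *
          ∫⁻ x in {x | ENNReal.ofReal t < a k x}, F x * (w : ℝ≥0∞) ^ k ∂μ := by
        refine tsum_congr fun k => ?_
        exact lintegral_mul_rpow_eq_lintegral_setLIntegral μ (hFm k) (ham k) hq
    _ = ∫⁻ t in Set.Ioi (0 : ℝ), ENNReal.ofReal (q * t ^ (q - 1)) *
          ∑' k, ∫⁻ x in {x | ENNReal.ofReal t < a k x}, F x * (w : ℝ≥0∞) ^ k ∂μ := by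
        rw [← lintegral_tsum]
        · simp only [ENNReal.tsum_mul_left]
        · intro k
          have h1 : Measurable fun t : ℝ => ENNReal.ofReal (q * t ^ (q - 1)) := by fun_prop
          exact (h1.mul (hanti k).measurable).aemeasurable
    _ ≤ ∫⁻ t in Set.Ioi (0 : ℝ), (1 - (w : ℝ≥0∞))⁻¹ * D * (ENNReal.ofReal (q * t ^ (q - 1)) *
          ∫⁻ x in {x | ENNReal.ofReal t < ⨆ k, a k x}, 1 ∂μ) := by
        refine lintegral_mono fun t => ?_
        rw [setLIntegral_const, one_mul, mul_left_comm]
        gcongr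
        exact hlevel _
    _ = _ := by
        rw [lintegral_const_mul' _ _ (ENNReal.mul_ne_top hKt ENNReal.coe_ne_top),
          ← lintegral_mul_rpow_eq_lintegral_setLIntegral μ measurable_const
            (Measurable.iSup ham) hq]
        simp only [one_mul]

/-- The fixed time estimate behind the potential estimate: a multiplier whose means of order `p₀`
over cells grow at most geometrically in the scale. -/
theorem lintegral_tsum_geometric_mul_le [SFinite μ] {τ : ℝ≥0} (hτ0 : 0 < τ) (hτ1 : τ < 1)
    {p₀ q : ℝ} (hq : 0 < q) (hqp : q < p₀) (D : ℝ≥0) :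
    ∃ C : ℝ≥0, ∀ (𝒟 : CellFiltration X μ ι) (c : X → ℝ≥0) (a : ℕ → X → ℝ≥0∞),
      Measurable c → (∀ k, Measurable (a k)) →
      (∀ k x y, 𝒟.idx k x = 𝒟.idx k y → a k x = a k y) →
      (∀ k x, ∫⁻ y in 𝒟.cell k x, ((c y * τ ^ k : ℝ≥0) : ℝ≥0∞) ^ p₀ ∂μ ≤ D * μ (𝒟.cell k x)) →
      ∫⁻ x, (∑' k, ((c x * τ ^ k : ℝ≥0) : ℝ≥0∞) * a k x) ^ q ∂μ ≤
        C * ∫⁻ x, (⨆ k, a k x) ^ q ∂μ := by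
  have hp₀ : 0 < p₀ := hq.trans hqp
  -- With the exponent `p₀ / q`, the `q`-th power turns the large coefficients into `(c * τ ^ k) ^
  -- p₀`, the quantity whose cell means are bounded.
  have hγ : 1 < p₀ / q := by rwa [one_lt_div hq]
  obtain ⟨K, hK⟩ := exists_tsum_geometric_mul_le hτ0 hτ1 hγ
  set w : ℝ≥0 := τ ^ p₀ with hw
  have hw1 : w < 1 := NNReal.rpow_lt_one hτ1 hp₀
  have hKt : (1 - (w : ℝ≥0∞))⁻¹ ≠ ∞ := by
    rw [ENNReal.inv_ne_top, Ne, tsub_eq_zero_iff_le, not_le]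
    exact_mod_cast hw1
  have hfin : (K : ℝ≥0∞) ^ q * (1 + (1 - (w : ℝ≥0∞))⁻¹ * D) ≠ ∞ :=
    ENNReal.mul_ne_top (ENNReal.rpow_ne_top_of_nonneg hq.le ENNReal.coe_ne_top)
      (ENNReal.add_ne_top.2 ⟨ENNReal.one_ne_top, ENNReal.mul_ne_top hKt ENNReal.coe_ne_top⟩)
  refine ⟨((K : ℝ≥0∞) ^ q * (1 + (1 - (w : ℝ≥0∞))⁻¹ * D)).toNNReal,
    fun 𝒟 c a hc ham ha hcD => ?_⟩
  rw [ENNReal.coe_toNNReal hfin]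
  have hF : Measurable fun x => (c x : ℝ≥0∞) ^ p₀ := hc.coe_nnreal_ennreal.pow_const p₀
  have hpow : ∀ x k, ((c x * τ ^ k : ℝ≥0) : ℝ≥0∞) ^ p₀ = (c x : ℝ≥0∞) ^ p₀ * (w : ℝ≥0∞) ^ k := by
    intro x k
    rw [ENNReal.coe_mul, ENNReal.mul_rpow_of_nonneg _ _ hp₀.le, ENNReal.coe_pow, hw,
      ENNReal.coe_rpow_of_nonneg _ hp₀.le, ← ENNReal.rpow_natCast, ← ENNReal.rpow_natCast,
      ← ENNReal.rpow_mul, ← ENNReal.rpow_mul, mul_comm (k : ℝ)]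
  simp only [hpow] at hcD
  have hcar := lintegral_tsum_mul_rpow_le hw1 hq hF ham ha hcD
  have hpt : ∀ x, (∑' k, ((c x * τ ^ k : ℝ≥0) : ℝ≥0∞) * a k x) ^ q ≤
      (K : ℝ≥0∞) ^ q * ((⨆ k, a k x) ^ q +
        ∑' k, (c x : ℝ≥0∞) ^ p₀ * (w : ℝ≥0∞) ^ k * a k x ^ q) := by
    intro x
    refine (ENNReal.rpow_le_rpow (hK (c x) fun k => a k x) hq.le).trans ?_
    rw [ENNReal.mul_rpow_of_nonneg _ _ hq.le]
    gcongr
    rw [← ENNReal.le_rpow_inv_iff hq]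
    refine iSup_le fun k => ?_
    rw [ENNReal.le_rpow_inv_iff hq, ENNReal.mul_rpow_of_nonneg _ _ hq.le]
    rcases le_total (1 : ℝ≥0∞) (((c x * τ ^ k : ℝ≥0) : ℝ≥0∞) ^ (p₀ / q)) with h | h
    · rw [max_eq_right h, ← ENNReal.rpow_mul, div_mul_cancel₀ _ hq.ne', hpow]
      exact (ENNReal.le_tsum (f := fun k => (c x : ℝ≥0∞) ^ p₀ * (w : ℝ≥0∞) ^ k * a k x ^ q) k).trans
        le_add_self
    · rw [max_eq_left h, ENNReal.one_rpow, one_mul]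
      refine le_trans ?_ le_self_add
      gcongr
      exact le_iSup (fun k => a k x) k
  refine (lintegral_mono hpt).trans ?_
  rw [lintegral_const_mul' _ _ (ENNReal.rpow_ne_top_of_nonneg hq.le ENNReal.coe_ne_top),
    lintegral_add_left ((Measurable.iSup ham).pow_const q), mul_assoc, add_mul, one_mul]
  gcongr

end CellFiltration

/-! ### The dyadic model of the adjoint potential, multiplied by `b`. -/

namespace CellFiltration

variable {T X : Type*} [MeasurableSpace T] [MeasurableSpace X] {μ : Measure T} {ν : Measure X}
  [SigmaFinite μ] [SigmaFinite ν] {ι κ : Type*} [MeasurableSpace ι] [MeasurableSpace κ]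

/-- The mean of `g` over the product of the cells of the `k`-th partitions. -/
noncomputable def prodAvg (𝒯 : CellFiltration T μ ι) (𝒳 : CellFiltration X ν κ) (k : ℕ)
    (g : T × X → ℝ≥0∞) (z : T × X) : ℝ≥0∞ :=
  𝒯.avg k (fun s => 𝒳.avg k (fun y => g (s, y)) z.2) z.1

variable [DiscreteMeasurableSpace ι] [Countable ι] [DiscreteMeasurableSpace κ] [Countable κ]

theorem measurable_avg_snd (𝒳 : CellFiltration X ν κ) (k : ℕ) {g : T × X → ℝ≥0∞}
    (hg : Measurable g) : Measurable fun z : T × X => 𝒳.avg k (fun y => g (z.1, y)) z.2 := by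
  have h1 : Measurable fun w : X × T => g (w.2, w.1) := hg.comp measurable_swap
  have h2 := (𝒳.measurable_avg_prod k h1).comp (measurable_swap (α := T) (β := X))
  simpa only [Function.comp_def, Prod.fst_swap, Prod.snd_swap] using h2

theorem measurable_maximal_snd (𝒳 : CellFiltration X ν κ) {g : T × X → ℝ≥0∞}
    (hg : Measurable g) : Measurable fun z : T × X => 𝒳.maximal (fun y => g (z.1, y)) z.2 :=
  Measurable.iSup fun k => measurable_avg_snd 𝒳 k hg

theorem measurable_prodAvg (𝒯 : CellFiltration T μ ι) (𝒳 : CellFiltration X ν κ) (k : ℕ)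
    {g : T × X → ℝ≥0∞} (hg : Measurable g) : Measurable (prodAvg 𝒯 𝒳 k g) := by
  unfold prodAvg
  exact 𝒯.measurable_avg_prod k (measurable_avg_snd 𝒳 k hg)

/-- Boundedness in mixed norm spaces of the dyadic model of the potential operator. -/
theorem mixed_tsum_mul_prodAvg_le {τ : ℝ≥0} (hτ0 : 0 < τ) (hτ1 : τ < 1) {p₀ p q : ℝ}
    (hp : 1 < p) (hq : 1 < q) (hqp : q < p₀) (D : ℝ≥0) :
    ∃ C : ℝ≥0, ∀ (𝒯 : CellFiltration T μ ι) (𝒳 : CellFiltration X ν κ) (c : T × X → ℝ≥0)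
      (g : T × X → ℝ≥0∞), Measurable c → Measurable g →
      (∀ t k x, ∫⁻ y in 𝒳.cell k x, ((c (t, y) * τ ^ k : ℝ≥0) : ℝ≥0∞) ^ p₀ ∂ν ≤
        D * ν (𝒳.cell k x)) →
      ∫⁻ t, (∫⁻ x, (∑' k, ((c (t, x) * τ ^ k : ℝ≥0) : ℝ≥0∞) * prodAvg 𝒯 𝒳 k g (t, x)) ^ q ∂ν)
        ^ (p / q) ∂μ ≤ C * ∫⁻ t, (∫⁻ x, g (t, x) ^ q ∂ν) ^ (p / q) ∂μ := by
  have hp0 : 0 < p := by linarith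
  have hq0 : 0 < q := by linarith
  have hpq : 0 ≤ p / q := by positivity
  obtain ⟨C₁, hC₁⟩ := lintegral_tsum_geometric_mul_le (μ := ν) (ι := κ) hτ0 hτ1 hq0 hqp D
  obtain ⟨C₂, hC₂⟩ := maximal_mixed (μ := μ) (ν := ν) (ι := ι) hp hq
  set C₃ : ℝ≥0 := (2 ^ q * q / (q - 1)).toNNReal with hC₃
  refine ⟨C₁ ^ (p / q) * (C₂ * C₃ ^ (p / q)), fun 𝒯 𝒳 c g hc hg hcD => ?_⟩
  have hhm := measurable_maximal_snd 𝒳 hg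
  have hfix : ∀ t, ∫⁻ x, (∑' k, ((c (t, x) * τ ^ k : ℝ≥0) : ℝ≥0∞) * prodAvg 𝒯 𝒳 k g (t, x)) ^ q ∂ν
      ≤ C₁ * ∫⁻ x, 𝒯.maximal (fun s => 𝒳.maximal (fun y => g (s, y)) x) t ^ q ∂ν := by
    intro t
    refine (hC₁ 𝒳 (fun x => c (t, x)) (fun k x => prodAvg 𝒯 𝒳 k g (t, x))
      (hc.comp measurable_prodMk_left)
      (fun k => (measurable_prodAvg 𝒯 𝒳 k hg).comp measurable_prodMk_left) ?_
      (hcD t)).trans ?_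
    · intro k x y hxy
      simp only [prodAvg, 𝒳.avg_eq _ hxy]
    · gcongr with x
      -- Enlarging the spatial average to the spatial maximal function, and then the time average to
      -- the time maximal function, decouples the two scales.
      refine iSup_le fun k => ?_
      refine le_trans ?_ (𝒯.avg_le_maximal k _ t)
      exact 𝒯.avg_mono k (fun s => 𝒳.avg_le_maximal k _ x) t
  have hsp : ∀ t, ∫⁻ x, 𝒳.maximal (fun y => g (t, y)) x ^ q ∂ν ≤ C₃ * ∫⁻ x, g (t, x) ^ q ∂ν :=
    fun t => lintegral_maximal_rpow_le hq (hg.comp measurable_prodMk_left)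
  calc _ ≤ ∫⁻ t, (C₁ * ∫⁻ x, 𝒯.maximal (fun s => 𝒳.maximal (fun y => g (s, y)) x) t ^ q ∂ν)
        ^ (p / q) ∂μ := lintegral_mono fun t => ENNReal.rpow_le_rpow (hfix t) hpq
    _ = (C₁ : ℝ≥0∞) ^ (p / q) *
        ∫⁻ t, (∫⁻ x, 𝒯.maximal (fun s => 𝒳.maximal (fun y => g (s, y)) x) t ^ q ∂ν) ^ (p / q) ∂μ := by
      rw [← lintegral_const_mul' _ _ (ENNReal.rpow_ne_top_of_nonneg hpq ENNReal.coe_ne_top)]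
      simp only [ENNReal.mul_rpow_of_nonneg _ _ hpq]
    _ ≤ (C₁ : ℝ≥0∞) ^ (p / q) * (C₂ *
        ∫⁻ t, (∫⁻ x, 𝒳.maximal (fun y => g (t, y)) x ^ q ∂ν) ^ (p / q) ∂μ) := by
      gcongr
      exact hC₂ 𝒯 (fun z => 𝒳.maximal (fun y => g (z.1, y)) z.2) hhm
    _ ≤ (C₁ : ℝ≥0∞) ^ (p / q) * (C₂ *
        ∫⁻ t, (C₃ * ∫⁻ x, g (t, x) ^ q ∂ν) ^ (p / q) ∂μ) := by
      gcongr with t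
      exact hsp t
    _ = _ := by
      simp only [ENNReal.mul_rpow_of_nonneg _ _ hpq]
      rw [lintegral_const_mul' _ _ (ENNReal.rpow_ne_top_of_nonneg hpq ENNReal.coe_ne_top)]
      push_cast
      rw [ENNReal.coe_rpow_of_nonneg _ hpq, ENNReal.coe_rpow_of_nonneg _ hpq]
      ring

end CellFiltration

/-! ### Grids shifted by a third of the mesh. -/

/-- The label of the interval containing `t` in the grid of mesh `(3m+1)^j`, shifted by a third of
the mesh if `e` is true. -/
noncomputable def gridIdx (m : ℕ) (e : Bool) (j : ℤ) (t : ℝ) : ℤ :=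
  ⌊t / ((3 * m + 1 : ℕ) : ℝ) ^ j - (e.toNat : ℝ) / 3⌋

/-- The base is congruent to 1 modulo 3, so a third of the coarse mesh is `m` fine meshes plus a
third of one. Hence the shifted grids are nested as well, the coarse label being a function of the
fine one. -/
theorem gridIdx_succ (m : ℕ) (e : Bool) (j : ℤ) (t : ℝ) :
    gridIdx m e (j + 1) t = (gridIdx m e j t - e.toNat * m) / ((3 * m + 1 : ℕ) : ℤ) := by
  have hB : ((3 * m + 1 : ℕ) : ℝ) ≠ 0 := by positivity
  unfold gridIdx
  rw [← Int.natCast_mul, ← Int.floor_sub_natCast, ← Int.floor_div_natCast]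
  congr 1
  rw [zpow_add_one₀ hB, eq_div_iff hB]
  have hBj : ((3 * m + 1 : ℕ) : ℝ) ^ j ≠ 0 := zpow_ne_zero _ hB
  field_simp
  push_cast
  ring

theorem measurable_gridIdx (m : ℕ) (e : Bool) (j : ℤ) : Measurable (gridIdx m e j) := by
  unfold gridIdx
  exact Int.measurable_floor.comp ((measurable_id.div_const _).sub_const _)

theorem setOf_gridIdx_eq (m : ℕ) (e : Bool) (j n : ℤ) :
    {t | gridIdx m e j t = n} =
      Set.Ico (((3 * m + 1 : ℕ) : ℝ) ^ j * (n + (e.toNat : ℝ) / 3))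
        (((3 * m + 1 : ℕ) : ℝ) ^ j * (n + 1 + (e.toNat : ℝ) / 3)) := by
  have hBj : 0 < ((3 * m + 1 : ℕ) : ℝ) ^ j := by positivity
  ext t
  simp only [Set.mem_Ico]
  show gridIdx m e j t = n ↔ _
  rw [gridIdx, Int.floor_eq_iff, le_sub_iff_add_le, le_div_iff₀ hBj, sub_lt_iff_lt_add,
    div_lt_iff₀ hBj, mul_comm, mul_comm ((n : ℝ) + 1 + _)]

theorem abs_sub_lt_of_gridIdx_eq {m : ℕ} {e : Bool} {j : ℤ} {s t : ℝ}
    (h : gridIdx m e j s = gridIdx m e j t) : |s - t| < ((3 * m + 1 : ℕ) : ℝ) ^ j := by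
  have h1 : s ∈ {y | gridIdx m e j y = gridIdx m e j t} := h
  have h2 : t ∈ {y | gridIdx m e j y = gridIdx m e j t} := rfl
  rw [setOf_gridIdx_eq] at h1 h2
  rw [abs_lt]
  constructor <;> nlinarith [h1.1, h1.2, h2.1, h2.2]

/-- Close points lie in a common interval of the grid or of its shift by a third. -/
theorem exists_gridIdx_eq (m : ℕ) (j : ℤ) {s t : ℝ}
    (h : |s - t| ≤ ((3 * m + 1 : ℕ) : ℝ) ^ j / 3) : ∃ e, gridIdx m e j s = gridIdx m e j t := by
  have hBj : 0 < ((3 * m + 1 : ℕ) : ℝ) ^ j := by positivity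
  wlog hst : s ≤ t generalizing s t
  · obtain ⟨e, he⟩ := this (by rwa [abs_sub_comm]) (le_of_not_ge hst)
    exact ⟨e, he.symm⟩
  by_contra hcon
  push Not at hcon
  set u := s / ((3 * m + 1 : ℕ) : ℝ) ^ j with hu
  set v := t / ((3 * m + 1 : ℕ) : ℝ) ^ j with hv
  have huv : u ≤ v := by rw [hu, hv]; gcongr
  have hvu : v - u ≤ 1 / 3 := by
    rw [hu, hv, ← sub_div, div_le_iff₀ hBj]
    rw [abs_sub_comm, abs_of_nonneg (by linarith)] at h
    linarith
  -- If both grids separated the points, the interval `(u, v]` would contain an integer and an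
  -- integer plus one third. These lie at least `1/3` apart, while `v - u ≤ 1/3` and `u` is
  -- excluded.
  have hf : ⌊u⌋ < ⌊v⌋ := by
    have := hcon false
    simp only [gridIdx, Bool.toNat_false, Nat.cast_zero, zero_div, sub_zero] at this
    exact lt_of_le_of_ne (Int.floor_le_floor huv) this
  have ht : ⌊u - 1 / 3⌋ < ⌊v - 1 / 3⌋ := by
    have := hcon true
    simp only [gridIdx, Bool.toNat_true, Nat.cast_one] at this
    exact lt_of_le_of_ne (Int.floor_le_floor (by linarith)) this
  have h1 : u < ⌊v⌋ := Int.floor_lt.1 hf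
  have h2 : (⌊v⌋ : ℝ) ≤ v := Int.floor_le v
  have h3 : u - 1 / 3 < ⌊v - 1 / 3⌋ := Int.floor_lt.1 ht
  have h4 : (⌊v - 1 / 3⌋ : ℝ) ≤ v - 1 / 3 := Int.floor_le _
  rcases le_or_gt ⌊v⌋ ⌊v - 1 / 3⌋ with hc | hc
  · have : (⌊v⌋ : ℝ) ≤ ⌊v - 1 / 3⌋ := by exact_mod_cast hc
    linarith
  · have : (⌊v - 1 / 3⌋ : ℝ) + 1 ≤ ⌊v⌋ := by exact_mod_cast hc
    linarith

theorem volume_setOf_gridIdx_eq (m : ℕ) (e : Bool) (j n : ℤ) :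
    volume {t | gridIdx m e j t = n} = ENNReal.ofReal (((3 * m + 1 : ℕ) : ℝ) ^ j) := by
  rw [setOf_gridIdx_eq, Real.volume_Ico]
  congr 1
  ring

theorem gridIdx_nested (m : ℕ) (e : Bool) (J : ℤ) (k : ℕ) {s t : ℝ}
    (h : gridIdx m e (J - (k + 1 : ℕ)) s = gridIdx m e (J - (k + 1 : ℕ)) t) :
    gridIdx m e (J - k) s = gridIdx m e (J - k) t := by
  have : J - (k : ℤ) = (J - (k + 1 : ℕ)) + 1 := by push_cast; ring
  rw [this, gridIdx_succ, gridIdx_succ, h]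

/-- The partitions of the real line into intervals of lengths `16^J, 16^(J-1), …`. -/
noncomputable def timeGrid (e : Bool) (J : ℤ) : CellFiltration ℝ volume ℤ where
  idx k := gridIdx 5 e (J - k)
  measurable_idx k := measurable_gridIdx _ _ _
  nested k _ _ h := gridIdx_nested 5 e J k h
  measure_ne_zero k t := by
    rw [volume_setOf_gridIdx_eq]
    exact (ENNReal.ofReal_pos.2 (by positivity)).ne'
  measure_ne_top k t := by
    rw [volume_setOf_gridIdx_eq]
    exact ENNReal.ofReal_ne_top

theorem volume_setOf_forall_gridIdx_eq {d : ℕ} (e : Fin d → Bool) (j : ℤ) (n : Fin d → ℤ) :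
    volume {x : EuclideanSpace ℝ (Fin d) | (fun i => gridIdx 1 (e i) j (x i)) = n} =
      ENNReal.ofReal ((4 : ℝ) ^ j) ^ d := by
  have h1 : {x : EuclideanSpace ℝ (Fin d) | (fun i => gridIdx 1 (e i) j (x i)) = n} =
      (MeasurableEquiv.toLp 2 (Fin d → ℝ)).symm ⁻¹'
        (Set.univ.pi fun i => {t | gridIdx 1 (e i) j t = n i}) := by
    ext x
    simp only [Set.mem_preimage, Set.mem_pi, Set.mem_univ, true_imp_iff]
    exact funext_iff
  rw [h1, (EuclideanSpace.volume_preserving_symm_measurableEquiv_toLp (Fin d)).measure_preimage_equiv,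
    volume_pi_pi]
  simp only [volume_setOf_gridIdx_eq]
  norm_num

/-- The partitions of Euclidean space into cubes of side lengths `4^J, 4^(J-1), …`. -/
noncomputable def spaceGrid {d : ℕ} (e : Fin d → Bool) (J : ℤ) :
    CellFiltration (EuclideanSpace ℝ (Fin d)) volume (Fin d → ℤ) where
  idx k x i := gridIdx 1 (e i) (J - k) (x i)
  measurable_idx k := by
    refine measurable_pi_lambda _ fun i => ?_
    exact (measurable_gridIdx _ _ _).comp (by fun_prop)
  nested k x y h := by
    funext i
    exact gridIdx_nested 1 (e i) J k (congrFun h i)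
  measure_ne_zero k x := by
    rw [volume_setOf_forall_gridIdx_eq]
    exact pow_ne_zero _ (ENNReal.ofReal_pos.2 (by positivity)).ne'
  measure_ne_top k x := by
    rw [volume_setOf_forall_gridIdx_eq]
    exact ENNReal.pow_ne_top ENNReal.ofReal_ne_top

theorem volume_timeGrid_cell (e : Bool) (J : ℤ) (k : ℕ) (t : ℝ) :
    volume ((timeGrid e J).cell k t) = ENNReal.ofReal ((16 : ℝ) ^ (J - k)) := by
  have := volume_setOf_gridIdx_eq 5 e (J - k) (gridIdx 5 e (J - k) t)
  norm_num at this
  exact this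

theorem volume_spaceGrid_cell {d : ℕ} (e : Fin d → Bool) (J : ℤ) (k : ℕ)
    (x : EuclideanSpace ℝ (Fin d)) :
    volume ((spaceGrid e J).cell k x) = ENNReal.ofReal ((4 : ℝ) ^ (J - k)) ^ d :=
  volume_setOf_forall_gridIdx_eq e (J - k) _

theorem spaceGrid_cell_subset_ball {d : ℕ} (e : Fin d → Bool) (J : ℤ) (k : ℕ)
    (x : EuclideanSpace ℝ (Fin d)) :
    (spaceGrid e J).cell k x ⊆ Metric.ball x ((d + 1) * (4 : ℝ) ^ (J - k)) := by
  intro y hy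
  have hL : 0 < (4 : ℝ) ^ (J - k) := by positivity
  have h1 : ∀ i, |y i - x i| < (4 : ℝ) ^ (J - k) := by
    intro i
    have := abs_sub_lt_of_gridIdx_eq (congrFun (show (fun i => gridIdx 1 (e i) (J - k) (y i)) =
      fun i => gridIdx 1 (e i) (J - k) (x i) from hy) i)
    norm_num at this
    exact this
  rw [Metric.mem_ball, dist_eq_norm, EuclideanSpace.norm_eq, Real.sqrt_lt' (by positivity)]
  calc ∑ i, ‖(y - x) i‖ ^ 2 ≤ ∑ _i : Fin d, ((4 : ℝ) ^ (J - k)) ^ 2 := by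
        gcongr with i
        rw [Real.norm_eq_abs]
        exact (h1 i).le
    _ = d * ((4 : ℝ) ^ (J - k)) ^ 2 := by simp
    _ < ((d + 1) * (4 : ℝ) ^ (J - k)) ^ 2 := by
        rw [mul_pow]
        gcongr
        nlinarith [(Nat.cast_nonneg d : (0 : ℝ) ≤ d)]

/-! ### Domination of the kernel by dyadic averages. -/

/-- The kernel is bounded by a negative power of the parabolic distance. -/
theorem parabolicKernel_le {d : ℕ} {α k : ℝ} (hk : 0 < k) (hα : α < d + 2) {s ρ R : ℝ}
    (hs : 0 < s) (hR : R = max (Real.sqrt s) ρ) :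
    parabolicKernel d α k s ρ ≤
      max 1 ((k * (((d : ℝ) + 2 - α) / 2)) ^ (((d : ℝ) + 2 - α) / 2)) * R ^ (-((d : ℝ) + 2 - α)) := by
  set γ := ((d : ℝ) + 2 - α) / 2 with hγ
  have hγ0 : 0 < γ := by rw [hγ]; linarith
  have h2γ : -((d : ℝ) + 2 - α) = 2 * (-γ) := by rw [hγ]; ring
  have hsq : 0 < Real.sqrt s := Real.sqrt_pos.2 hs
  rw [h2γ, parabolicKernel, if_pos hs]
  rcases le_total ρ (Real.sqrt s) with h | h
  · rw [max_eq_left h] at hR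
    have e1 : R ^ (2 * (-γ)) = 1 / s ^ γ := by
      rw [Real.rpow_mul (by rw [hR]; exact hsq.le), hR, Real.rpow_two, Real.sq_sqrt hs.le,
        Real.rpow_neg hs.le, one_div]
    rw [e1, mul_comm]
    gcongr
    refine le_trans ?_ (le_max_left _ _)
    rw [Real.exp_le_one_iff]
    exact div_nonpos_of_nonpos_of_nonneg (by nlinarith) (by positivity)
  · rw [max_eq_right h] at hR
    have hρ0 : 0 < ρ := hsq.trans_le h
    have e1 : R ^ (2 * (-γ)) = 1 / (ρ ^ 2) ^ γ := by
      rw [Real.rpow_mul (by rw [hR]; exact hρ0.le), hR, Real.rpow_two,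
        Real.rpow_neg (by positivity), one_div]
    rw [e1]
    set v := ρ ^ 2 / (k * s) with hv
    have hv0 : 0 < v := by positivity
    have e2 : -ρ ^ 2 / (k * s) = -v := by rw [hv]; ring
    have e3 : (ρ ^ 2) ^ γ = (v / γ) ^ γ * (k * γ) ^ γ * s ^ γ := by
      rw [← Real.mul_rpow (by positivity) (by positivity),
        ← Real.mul_rpow (by positivity) (by positivity)]
      congr 1
      rw [hv]; field_simp
    -- The inequality `y ≤ exp y` at `y = v / γ`, raised to the power `γ`. It trades the Gaussian
    -- for a power of `ρ ^ 2 / s` and produces the constant `(k * γ) ^ γ`.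
    have e4 : (v / γ) ^ γ ≤ Real.exp v := by
      have h1 : v / γ ≤ Real.exp (v / γ) := by linarith [Real.add_one_le_exp (v / γ)]
      calc (v / γ) ^ γ ≤ Real.exp (v / γ) ^ γ := Real.rpow_le_rpow (by positivity) h1 hγ0.le
        _ = Real.exp v := by rw [← Real.exp_mul, div_mul_cancel₀ _ hγ0.ne']
    have hsγ : 0 < s ^ γ := by positivity
    have hkγ : 0 < (k * γ) ^ γ := by positivity
    rw [e2, Real.exp_neg]
    refine le_trans ?_ (mul_le_mul_of_nonneg_right (le_max_right _ _) (by positivity))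
    have e5 : (k * γ) ^ γ * (1 / (ρ ^ 2) ^ γ) = 1 / s ^ γ * ((v / γ) ^ γ)⁻¹ := by
      rw [e3]; field_simp
    rw [e5]
    gcongr

/-- The kernel is dominated by indicators of parabolic boxes of dyadic sizes. -/
theorem exists_parabolicKernel_le (d : ℕ) {α k : ℝ} (hk : 0 < k) (hα : α < d + 2) :
    ∃ C : ℝ≥0, ∀ (s : ℝ) (y : EuclideanSpace ℝ (Fin d)), 0 < s → ∃ j : ℤ,
      parabolicKernel d α k s ‖y‖ ≤ C * ((4 : ℝ) ^ j) ^ (-((d : ℝ) + 2 - α)) ∧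
      s ≤ (16 : ℝ) ^ j / 3 ∧ ∀ i, |y i| ≤ (4 : ℝ) ^ j / 3 := by
  set C₀ := max 1 ((k * (((d : ℝ) + 2 - α) / 2)) ^ (((d : ℝ) + 2 - α) / 2)) with hC₀
  have hC₀0 : 0 ≤ C₀ := le_trans zero_le_one (le_max_left _ _)
  refine ⟨⟨C₀ * 12 ^ ((d : ℝ) + 2 - α), by positivity⟩, fun s y hs => ?_⟩
  set R := max (Real.sqrt s) ‖y‖ with hR
  have hR0 : 0 < R := lt_max_of_lt_left (Real.sqrt_pos.2 hs)
  -- The factor 3 leaves room for the thirds in the shifted grids. The scale `4 ^ (n + 1)` lies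
  -- between `3 * R` and `12 * R`, which explains the constant 12.
  obtain ⟨n, hn1, hn2⟩ := exists_mem_Ioc_zpow (x := 3 * R) (y := (4 : ℝ)) (by positivity) (by norm_num)
  have h4 : (4 : ℝ) ^ (n + 1) = 4 * 4 ^ n := by rw [zpow_add_one₀ (by norm_num)]; ring
  refine ⟨n + 1, ?_, ?_, fun i => ?_⟩
  · refine (parabolicKernel_le hk hα hs hR).trans ?_
    show C₀ * _ ≤ C₀ * 12 ^ ((d : ℝ) + 2 - α) * _
    rw [mul_assoc]
    gcongr
    have hL : (4 : ℝ) ^ (n + 1) ≤ 12 * R := by rw [h4]; linarith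
    have e : (12 : ℝ) ^ ((d : ℝ) + 2 - α) = (1 / 12) ^ (-((d : ℝ) + 2 - α)) := by
      rw [one_div, Real.inv_rpow (by norm_num), Real.rpow_neg (by norm_num), inv_inv]
    rw [e, ← Real.mul_rpow (by norm_num) (by positivity)]
    refine Real.rpow_le_rpow_of_nonpos (by positivity) ?_ (by linarith)
    linarith
  · have h1 : s ≤ R ^ 2 := by
      rw [← Real.sq_sqrt hs.le]
      exact pow_le_pow_left₀ (Real.sqrt_nonneg s) (le_max_left _ _) 2
    have h2 : (16 : ℝ) ^ (n + 1) = ((4 : ℝ) ^ (n + 1)) ^ 2 := by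
      rw [← zpow_natCast, ← zpow_mul, mul_comm, zpow_mul]; norm_num
    rw [h2]
    nlinarith
  · have h1 : |y i| ≤ R := (PiLp.norm_apply_le y i).trans (le_max_right _ _)
    linarith

/-- A cell filtration has a coarsest level, so sums over all scales are reached through bounds
uniform in the top scale `J`. -/
theorem ENNReal.tsum_int_le_of_forall_tsum_nat_le {v : ℤ → ℝ≥0∞} {B : ℝ≥0∞}
    (h : ∀ J : ℤ, ∑' k : ℕ, v (J - k) ≤ B) : ∑' j, v j ≤ B := by
  rw [ENNReal.tsum_eq_iSup_sum]
  refine iSup_le fun s => ?_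
  obtain ⟨J, hJ⟩ := s.bddAbove
  refine le_trans ?_ (h J)
  rw [← Finset.sum_coe_sort]
  have hinj : Function.Injective fun j : s => (J - (j : ℤ)).toNat := by
    intro i j hij
    have h1 := hJ i.2
    have h2 := hJ j.2
    ext
    simp only at hij
    omega
  calc ∑ j : s, v j = ∑' j : s, v (J - ((J - (j : ℤ)).toNat : ℤ)) := by
        rw [tsum_fintype]
        refine Finset.sum_congr rfl fun j _ => ?_
        congr 1
        have := hJ j.2
        omega
    _ ≤ _ := ENNReal.tsum_comp_le_tsum_of_injective hinj fun k : ℕ => v (J - k)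

/-- Hölder's inequality in mixed norm spaces. -/
theorem lintegral_lintegral_mul_le_mixed {T X : Type*} [MeasurableSpace T] [MeasurableSpace X]
    (μ : Measure T) (ν : Measure X) [SFinite ν] {r s r' s' : ℝ} (hr : r.HolderConjugate r')
    (hs : s.HolderConjugate s') {F G : T × X → ℝ≥0∞} (hF : Measurable F) (hG : Measurable G) :
    ∫⁻ t, ∫⁻ x, F (t, x) * G (t, x) ∂ν ∂μ ≤
      (∫⁻ t, (∫⁻ x, F (t, x) ^ s ∂ν) ^ (r / s) ∂μ) ^ (1 / r) *
        (∫⁻ t, (∫⁻ x, G (t, x) ^ s' ∂ν) ^ (r' / s') ∂μ) ^ (1 / r') := by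
  have hFm : Measurable fun t => (∫⁻ x, F (t, x) ^ s ∂ν) ^ (1 / s) :=
    ((hF.pow_const s).lintegral_prod_right').pow_const _
  have hGm : Measurable fun t => (∫⁻ x, G (t, x) ^ s' ∂ν) ^ (1 / s') :=
    ((hG.pow_const s').lintegral_prod_right').pow_const _
  calc ∫⁻ t, ∫⁻ x, F (t, x) * G (t, x) ∂ν ∂μ
      ≤ ∫⁻ t, (∫⁻ x, F (t, x) ^ s ∂ν) ^ (1 / s) * (∫⁻ x, G (t, x) ^ s' ∂ν) ^ (1 / s') ∂μ := by
        refine lintegral_mono fun t => ?_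
        exact ENNReal.lintegral_mul_le_Lp_mul_Lq ν hs (hF.comp measurable_prodMk_left).aemeasurable
          (hG.comp measurable_prodMk_left).aemeasurable
    _ ≤ _ := ENNReal.lintegral_mul_le_Lp_mul_Lq μ hr hFm.aemeasurable hGm.aemeasurable
    _ = _ := by
        simp only [← ENNReal.rpow_mul, one_div_mul_eq_div]

/-- The mean of `g` over the box of the `j`-th parabolic grid that contains `z`. -/
noncomputable def boxAvg {d : ℕ} (e : Bool × (Fin d → Bool)) (j : ℤ) (g : SpaceTime d → ℝ≥0∞)
    (z : SpaceTime d) : ℝ≥0∞ :=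
  CellFiltration.prodAvg (timeGrid e.1 j) (spaceGrid e.2 j) 0 g z

theorem prodAvg_grid {d : ℕ} (e : Bool × (Fin d → Bool)) (J : ℤ) (k : ℕ)
    (g : SpaceTime d → ℝ≥0∞) (z : SpaceTime d) :
    CellFiltration.prodAvg (timeGrid e.1 J) (spaceGrid e.2 J) k g z = boxAvg e (J - k) g z := by
  simp [boxAvg, CellFiltration.prodAvg, CellFiltration.avg, CellFiltration.cell, timeGrid,
    spaceGrid]

theorem measurable_boxAvg {d : ℕ} (e : Bool × (Fin d → Bool)) (j : ℤ) {g : SpaceTime d → ℝ≥0∞}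
    (hg : Measurable g) : Measurable (boxAvg e j g) :=
  CellFiltration.measurable_prodAvg _ _ 0 hg

/-- The box of the `j`-th parabolic grid that contains `z`. -/
def gridBox {d : ℕ} (e : Bool × (Fin d → Bool)) (j : ℤ) (z : SpaceTime d) : Set (SpaceTime d) :=
  (timeGrid e.1 j).cell 0 z.1 ×ˢ (spaceGrid e.2 j).cell 0 z.2

theorem measurableSet_gridBox {d : ℕ} (e : Bool × (Fin d → Bool)) (j : ℤ) (z : SpaceTime d) :
    MeasurableSet (gridBox e j z) :=
  ((timeGrid e.1 j).measurableSet_cell 0 z.1).prod ((spaceGrid e.2 j).measurableSet_cell 0 z.2)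

/-- With `L = 4 ^ j` the box has volume `L ^ (d + 2)`, since its time side is `16 ^ j = L ^ 2`. -/
theorem mul_setLIntegral_gridBox {d : ℕ} (e : Bool × (Fin d → Bool)) (j : ℤ) (α : ℝ)
    {g : SpaceTime d → ℝ≥0∞} (hg : Measurable g) (z : SpaceTime d) :
    ENNReal.ofReal (((4 : ℝ) ^ j) ^ (-((d : ℝ) + 2 - α))) * ∫⁻ w in gridBox e j z, g w =
      ENNReal.ofReal (((4 : ℝ) ^ j) ^ α) * boxAvg e j g z := by
  have hL : 0 < (4 : ℝ) ^ j := by positivity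
  have h1 : ∫⁻ w in gridBox e j z, g w = ∫⁻ s in (timeGrid e.1 j).cell 0 z.1,
      ∫⁻ y in (spaceGrid e.2 j).cell 0 z.2, g (s, y) := by
    rw [gridBox, Measure.volume_eq_prod, setLIntegral_prod _ hg.aemeasurable]
  have h2 : boxAvg e j g z = (volume ((timeGrid e.1 j).cell 0 z.1))⁻¹ *
      ((volume ((spaceGrid e.2 j).cell 0 z.2))⁻¹ * ∫⁻ w in gridBox e j z, g w) := by
    rw [h1, boxAvg, CellFiltration.prodAvg, CellFiltration.avg]
    congr 1
    rw [← lintegral_const_mul' _ _ 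
      (ENNReal.inv_ne_top.2 (show volume ((spaceGrid e.2 j).cell 0 z.2) ≠ 0 from
        (spaceGrid e.2 j).measure_ne_zero 0 z.2))]
    rfl
  rw [h2, volume_timeGrid_cell, volume_spaceGrid_cell, ← mul_assoc, ← mul_assoc]
  congr 1
  rw [Nat.cast_zero, sub_zero, ← ENNReal.ofReal_pow hL.le,
    ← ENNReal.ofReal_inv_of_pos (by positivity), ← ENNReal.ofReal_inv_of_pos (by positivity),
    ← ENNReal.ofReal_mul (by positivity), ← ENNReal.ofReal_mul (by positivity)]
  congr 1
  have h3 : (16 : ℝ) ^ j = ((4 : ℝ) ^ j) ^ 2 := by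
    rw [← zpow_natCast, ← zpow_mul, mul_comm, zpow_mul]; norm_num
  have h4 : -((d : ℝ) + 2 - α) = α - ((d + 2 : ℕ) : ℝ) := by push_cast; ring
  rw [h3, h4, Real.rpow_sub hL, Real.rpow_natCast]
  field_simp
  ring

/-- The kernel is dominated by finitely many dyadic kernels. -/
theorem exists_lintegral_parabolicKernel_mul_le (d : ℕ) {α k : ℝ} (hk : 0 < k) (hα : α < d + 2) :
    ∃ C : ℝ≥0, ∀ (g : SpaceTime d → ℝ≥0∞), Measurable g → ∀ z : SpaceTime d,
      ∫⁻ w : SpaceTime d,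
          ENNReal.ofReal (parabolicKernel d α k (z.1 - w.1) ‖z.2 - w.2‖) * g w ≤
        C * ∑ e : Bool × (Fin d → Bool), ∑' j : ℤ,
          ENNReal.ofReal (((4 : ℝ) ^ j) ^ α) * boxAvg e j g z := by
  obtain ⟨C, hC⟩ := exists_parabolicKernel_le d hk hα
  refine ⟨C, fun g hg z => ?_⟩
  set v : ℤ → ℝ≥0∞ := fun j => ENNReal.ofReal (((4 : ℝ) ^ j) ^ (-((d : ℝ) + 2 - α))) with hv
  have hpt : ∀ w : SpaceTime d,
      ENNReal.ofReal (parabolicKernel d α k (z.1 - w.1) ‖z.2 - w.2‖) * g w ≤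
        C * ∑ e : Bool × (Fin d → Bool), ∑' j : ℤ, v j * (gridBox e j z).indicator g w := by
    intro w
    by_cases hs : 0 < z.1 - w.1
    · obtain ⟨j, hj1, hj2, hj3⟩ := hC (z.1 - w.1) (z.2 - w.2) hs
      obtain ⟨e₀, he₀⟩ := exists_gridIdx_eq 5 j (s := w.1) (t := z.1) (by
        rw [abs_sub_comm, abs_of_pos hs]; norm_num; linarith)
      have hx : ∀ i, ∃ e, gridIdx 1 e j (w.2 i) = gridIdx 1 e j (z.2 i) := fun i =>
        exists_gridIdx_eq 1 j (by
          have := hj3 i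
          rw [abs_sub_comm]; norm_num; simpa using this)
      choose e₁ he₁ using hx
      have hmem : w ∈ gridBox (e₀, e₁) j z := by
        refine ⟨?_, ?_⟩
        · simpa [CellFiltration.cell, timeGrid] using he₀
        · simpa [CellFiltration.cell, spaceGrid] using funext he₁
      calc ENNReal.ofReal (parabolicKernel d α k (z.1 - w.1) ‖z.2 - w.2‖) * g w
          ≤ C * (v j * (gridBox (e₀, e₁) j z).indicator g w) := by
            rw [Set.indicator_of_mem hmem, ← mul_assoc]
            gcongr
            refine (ENNReal.ofReal_le_ofReal hj1).trans (le_of_eq ?_)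
            rw [ENNReal.ofReal_mul (NNReal.coe_nonneg C), ENNReal.ofReal_coe_nnreal]
        _ ≤ C * ∑' j : ℤ, v j * (gridBox (e₀, e₁) j z).indicator g w := by
            gcongr
            exact ENNReal.le_tsum (f := fun j => v j * (gridBox (e₀, e₁) j z).indicator g w) j
        _ ≤ _ := by
            gcongr
            exact Finset.single_le_sum
              (f := fun e : Bool × (Fin d → Bool) => ∑' j : ℤ, v j * (gridBox e j z).indicator g w)
              (fun _ _ => bot_le) (Finset.mem_univ (e₀, e₁))
    · have : parabolicKernel d α k (z.1 - w.1) ‖z.2 - w.2‖ = 0 := if_neg hs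
      rw [this]; simp
  have hm : ∀ e j, Measurable fun w => v j * (gridBox e j z).indicator g w := fun e j =>
    (hg.indicator (measurableSet_gridBox e j z)).const_mul _
  refine (lintegral_mono hpt).trans (le_of_eq ?_)
  rw [lintegral_const_mul' _ _ ENNReal.coe_ne_top,
    lintegral_finsetSum _ (fun e _ => Measurable.tsum (hm e))]
  congr 1
  refine Finset.sum_congr rfl fun e _ => ?_
  rw [lintegral_tsum fun j => (hm e j).aemeasurable]
  refine tsum_congr fun j => ?_
  rw [lintegral_const_mul _ (hg.indicator (measurableSet_gridBox e j z)),
    lintegral_indicator (measurableSet_gridBox e j z), mul_setLIntegral_gridBox e j α hg z]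

/-! ### The adjoint potential and the estimate for measurable functions. -/

theorem measurable_parabolicKernel (d : ℕ) (α k : ℝ) :
    Measurable fun w : SpaceTime d => ENNReal.ofReal (parabolicKernel d α k w.1 ‖w.2‖) := by
  unfold parabolicKernel
  refine ENNReal.measurable_ofReal.comp (Measurable.ite ?_ (by fun_prop) measurable_const)
  exact measurableSet_lt measurable_const measurable_fst

theorem measurable_parabolicPotential {d : ℕ} (α k : ℝ) {h : SpaceTime d → ℝ≥0∞}
    (hh : Measurable h) : Measurable (parabolicPotential α k h) := by
  unfold parabolicPotential
  have : Measurable fun p : SpaceTime d × SpaceTime d =>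
      ENNReal.ofReal (parabolicKernel d α k p.2.1 ‖p.2.2‖) * h (p.1.1 + p.2.1, p.1.2 + p.2.2) := by
    refine ((measurable_parabolicKernel d α k).comp measurable_snd).mul (hh.comp ?_)
    fun_prop
  exact this.lintegral_prod_right'

/-- Translation invariance followed by Tonelli's theorem. The inner integral on the right is the
adjoint potential, which looks backwards in time. -/
theorem lintegral_parabolicPotential_mul {d : ℕ} (α k : ℝ) {h g : SpaceTime d → ℝ≥0∞}
    (hh : Measurable h) (hg : Measurable g) :
    ∫⁻ z, parabolicPotential α k h z * g z = ∫⁻ z, h z * ∫⁻ w : SpaceTime d,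
      ENNReal.ofReal (parabolicKernel d α k (z.1 - w.1) ‖z.2 - w.2‖) * g w := by
  have hKm := measurable_parabolicKernel d α k
  have hKsub : Measurable fun p : SpaceTime d × SpaceTime d =>
      ENNReal.ofReal (parabolicKernel d α k (p.1.1 - p.2.1) ‖p.1.2 - p.2.2‖) :=
    hKm.comp (measurable_fst.sub measurable_snd)
  have h1 : ∀ w : SpaceTime d, parabolicPotential α k h w * g w = ∫⁻ z : SpaceTime d,
      ENNReal.ofReal (parabolicKernel d α k (z.1 - w.1) ‖z.2 - w.2‖) * h z * g w := by
    intro w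
    have hm : Measurable fun z : SpaceTime d =>
        ENNReal.ofReal (parabolicKernel d α k (z.1 - w.1) ‖z.2 - w.2‖) * h z :=
      (hKsub.comp (measurable_id.prodMk measurable_const)).mul hh
    rw [lintegral_mul_const _ hm]
    congr 1
    unfold parabolicPotential
    have : (volume : Measure (SpaceTime d)).IsAddLeftInvariant := by
      rw [Measure.volume_eq_prod]; infer_instance
    rw [← lintegral_sub_right_eq_self _ w]
    refine lintegral_congr fun z => ?_
    simp
  simp only [h1]
  rw [lintegral_lintegral_swap]
  · refine lintegral_congr fun z => ?_
    have hm : Measurable fun w : SpaceTime d =>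
        ENNReal.ofReal (parabolicKernel d α k (z.1 - w.1) ‖z.2 - w.2‖) * g w :=
      (hKsub.comp (measurable_const.prodMk measurable_id)).mul hg
    rw [← lintegral_const_mul _ hm]
    refine lintegral_congr fun w => ?_
    ring
  · refine Measurable.aemeasurable ?_
    refine Measurable.mul (Measurable.mul ?_ (hh.comp measurable_snd)) (hg.comp measurable_fst)
    exact hKm.comp (measurable_snd.sub measurable_fst)

/-- A Morrey bound over balls gives the bound over dyadic cubes. -/
theorem setLIntegral_spaceGrid_cell_le {d : ℕ} {α p₀ : ℝ} (hα : 0 < α) (hp₀ : 0 < p₀)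
    {β : EuclideanSpace ℝ (Fin d) → ℝ≥0} {M : ℝ≥0} (hM : M ≠ 0)
    (hβ : ∀ (ρ : ℝ) (x : EuclideanSpace ℝ (Fin d)), 0 < ρ →
      ∫⁻ y in Metric.ball x ρ, (β y : ℝ≥0∞) ^ p₀ ≤
        volume (Metric.ball x ρ) * (M * ENNReal.ofReal (ρ ^ (-α))) ^ p₀)
    (e : Fin d → Bool) (J : ℤ) (k : ℕ) (x : EuclideanSpace ℝ (Fin d)) :
    ∫⁻ y in (spaceGrid e J).cell k x,
        ((β y * M⁻¹ * (((4 : ℝ) ^ (J - k)) ^ α).toNNReal : ℝ≥0) : ℝ≥0∞) ^ p₀ ≤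
      ((((d : ℝ) + 1) ^ d).toNNReal *
        (volume (Metric.ball (0 : EuclideanSpace ℝ (Fin d)) 1)).toNNReal : ℝ≥0) *
        volume ((spaceGrid e J).cell k x) := by
  set L : ℝ := (4 : ℝ) ^ (J - k) with hL
  have hL0 : 0 < L := by positivity
  -- The cell of side `L` lies in this ball. The constant is the volume ratio `(d + 1) ^ d * |B_1|`,
  -- and `L ^ α * ρ ^ (-α) ≤ 1` because `L ≤ ρ`.
  set ρ : ℝ := (d + 1) * L with hρ
  have hρ0 : 0 < ρ := by positivity
  have hLρ : L ≤ ρ := by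
    rw [hρ]
    exact le_mul_of_one_le_left hL0.le (by linarith [(Nat.cast_nonneg d : (0 : ℝ) ≤ d)])
  have hMM : (M : ℝ≥0∞) ≠ 0 := by exact_mod_cast hM
  have hpt : ∀ y, ((β y * M⁻¹ * (L ^ α).toNNReal : ℝ≥0) : ℝ≥0∞) ^ p₀ =
      ((M : ℝ≥0∞)⁻¹ * ENNReal.ofReal (L ^ α)) ^ p₀ * (β y : ℝ≥0∞) ^ p₀ := by
    intro y
    rw [← ENNReal.mul_rpow_of_nonneg _ _ hp₀.le]
    congr 1
    rw [ENNReal.coe_mul, ENNReal.coe_mul, ENNReal.coe_inv hM]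
    show _ * ENNReal.ofReal (L ^ α) = _
    ring
  simp only [hpt]
  have hct : ((M : ℝ≥0∞)⁻¹ * ENNReal.ofReal (L ^ α)) ^ p₀ ≠ ∞ :=
    ENNReal.rpow_ne_top_of_nonneg hp₀.le
      (ENNReal.mul_ne_top (ENNReal.inv_ne_top.2 hMM) ENNReal.ofReal_ne_top)
  rw [lintegral_const_mul' _ _ hct]
  calc _ ≤ ((M : ℝ≥0∞)⁻¹ * ENNReal.ofReal (L ^ α)) ^ p₀ *
        (volume (Metric.ball x ρ) * (M * ENNReal.ofReal (ρ ^ (-α))) ^ p₀) := by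
        gcongr
        exact (lintegral_mono_set (spaceGrid_cell_subset_ball e J k x)).trans (hβ ρ x hρ0)
    _ = (((M : ℝ≥0∞)⁻¹ * M) * (ENNReal.ofReal (L ^ α) * ENNReal.ofReal (ρ ^ (-α)))) ^ p₀ *
        volume (Metric.ball x ρ) := by
        rw [mul_left_comm, ← ENNReal.mul_rpow_of_nonneg _ _ hp₀.le, mul_comm]
        congr 2
        ring
    _ ≤ 1 ^ p₀ * volume (Metric.ball x ρ) := by
        gcongr
        rw [ENNReal.inv_mul_cancel hMM ENNReal.coe_ne_top, one_mul,
          ← ENNReal.ofReal_mul (by positivity), ENNReal.ofReal_le_one, Real.rpow_neg hρ0.le,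
          ← div_eq_mul_inv, div_le_one (by positivity)]
        gcongr
    _ = _ := by
        rw [ENNReal.one_rpow, one_mul, Measure.addHaar_ball_of_pos _ _ hρ0,
          finrank_euclideanSpace_fin, volume_spaceGrid_cell, ← hL, hρ, mul_pow,
          ENNReal.ofReal_mul (by positivity), ENNReal.ofReal_pow hL0.le, ENNReal.coe_mul,
          ENNReal.coe_toNNReal measure_ball_lt_top.ne]
        show _ = ENNReal.ofReal _ * _ * _
        ring

/-- The dyadic form of the potential estimate, dualized. -/
theorem exists_lintegral_mul_tsum_boxAvg_le {d : ℕ} {p₀ α r s r' s' : ℝ} (hα : 0 < α)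
    (hr : r.HolderConjugate r') (hs : s.HolderConjugate s') (hs' : s' < p₀) :
    ∃ N : ℝ≥0, ∀ (b f : SpaceTime d → ℝ≥0) (g : SpaceTime d → ℝ≥0∞) (M : ℝ≥0),
      Measurable b → Measurable f → Measurable g → M ≠ 0 →
      (∀ (t ρ : ℝ) (x : EuclideanSpace ℝ (Fin d)), 0 < ρ →
        ∫⁻ y in Metric.ball x ρ, (b (t, y) : ℝ≥0∞) ^ p₀ ≤
          volume (Metric.ball x ρ) * (M * ENNReal.ofReal (ρ ^ (-α))) ^ p₀) →
      ∀ e : Bool × (Fin d → Bool),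
      ∫⁻ z, (b z * f z : ℝ≥0∞) *
          ∑' j : ℤ, ENNReal.ofReal (((4 : ℝ) ^ j) ^ α) * boxAvg e j g z ≤
        N * M * (∫⁻ t, (∫⁻ x, (f (t, x) : ℝ≥0∞) ^ s) ^ (r / s)) ^ (1 / r) *
          (∫⁻ t, (∫⁻ x, g (t, x) ^ s') ^ (r' / s')) ^ (1 / r') := by
  have hp₀ : 0 < p₀ := hs.symm.pos.trans hs'
  have hr0' := hr.symm.pos
  set τ : ℝ≥0 := ((4 : ℝ) ^ (-α)).toNNReal with hτ
  have hτR : (τ : ℝ) = (4 : ℝ) ^ (-α) := Real.coe_toNNReal _ (by positivity)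
  have hτ0 : 0 < τ := by rw [← NNReal.coe_pos, hτR]; positivity
  have hτ1 : τ < 1 := by
    rw [← NNReal.coe_lt_one, hτR]
    exact Real.rpow_lt_one_of_one_lt_of_neg (by norm_num) (by linarith)
  obtain ⟨C, hC⟩ := CellFiltration.mixed_tsum_mul_prodAvg_le (μ := (volume : Measure ℝ))
    (ν := (volume : Measure (EuclideanSpace ℝ (Fin d)))) (ι := ℤ) (κ := Fin d → ℤ)
    hτ0 hτ1 hr.symm.lt hs.symm.lt hs'
    ((((d : ℝ) + 1) ^ d).toNNReal *
        (volume (Metric.ball (0 : EuclideanSpace ℝ (Fin d)) 1)).toNNReal)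
  refine ⟨C ^ (1 / r'), fun b f g M hb hf hg hM hbM e => ?_⟩
  have hbm : Measurable fun z => (b z * f z : ℝ≥0∞) :=
    hb.coe_nnreal_ennreal.mul hf.coe_nnreal_ennreal
  have hum : ∀ j : ℤ, Measurable fun z =>
      (b z * f z : ℝ≥0∞) * (ENNReal.ofReal (((4 : ℝ) ^ j) ^ α) * boxAvg e j g z) := fun j =>
    hbm.mul ((measurable_boxAvg e j hg).const_mul _)
  simp only [← ENNReal.tsum_mul_left]
  rw [lintegral_tsum fun j => (hum j).aemeasurable]
  refine ENNReal.tsum_int_le_of_forall_tsum_nat_le fun J => ?_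
  rw [← lintegral_tsum fun k : ℕ => (hum (J - k)).aemeasurable]
  -- Below the top scale `J` the coefficients form a geometric sequence: with `τ = 4 ^ (-α)`, `c z *
  -- τ ^ k` is `b z / M` times the weight of scale `J - k`. Dividing by `M` makes the bound on cell
  -- means depend on `d` only.
  set c : SpaceTime d → ℝ≥0 := fun z => b z * M⁻¹ * (((4 : ℝ) ^ J) ^ α).toNNReal with hc
  have hcm : Measurable c := (hb.mul_const _).mul_const _
  have hcτ : ∀ z (k : ℕ), c z * τ ^ k = b z * M⁻¹ * (((4 : ℝ) ^ (J - k)) ^ α).toNNReal := by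
    intro z k
    simp only [hc, mul_assoc]
    congr 2
    rw [← NNReal.coe_inj, NNReal.coe_mul, NNReal.coe_pow, hτR, Real.coe_toNNReal _ (by positivity),
      Real.coe_toNNReal _ (by positivity), ← Real.rpow_intCast, ← Real.rpow_intCast,
      ← Real.rpow_natCast, ← Real.rpow_mul (by norm_num), ← Real.rpow_mul (by norm_num),
      ← Real.rpow_mul (by norm_num), ← Real.rpow_add (by norm_num)]
    congr 1
    push_cast
    ring
  set G : SpaceTime d → ℝ≥0∞ := fun z => ∑' k : ℕ, ((c z * τ ^ k : ℝ≥0) : ℝ≥0∞) *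
    CellFiltration.prodAvg (timeGrid e.1 J) (spaceGrid e.2 J) k g z with hG
  have hGm : Measurable G := Measurable.tsum fun k =>
    (hcm.mul_const _).coe_nnreal_ennreal.mul (CellFiltration.measurable_prodAvg _ _ k hg)
  have hsum : ∀ z, ∑' k : ℕ, (b z * f z : ℝ≥0∞) *
      (ENNReal.ofReal (((4 : ℝ) ^ (J - k)) ^ α) * boxAvg e (J - k) g z) = M * (f z * G z) := by
    intro z
    simp only [hG, ← ENNReal.tsum_mul_left]
    refine tsum_congr fun k => ?_
    rw [hcτ, prodAvg_grid, ENNReal.coe_mul, ENNReal.coe_mul, ENNReal.coe_inv hM]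
    change _ = (M : ℝ≥0∞) * (f z * ((b z : ℝ≥0∞) * (M : ℝ≥0∞)⁻¹ *
      ENNReal.ofReal (((4 : ℝ) ^ (J - k)) ^ α) * boxAvg e (J - k) g z))
    have hMM : (M : ℝ≥0∞) * (M : ℝ≥0∞)⁻¹ = 1 :=
      ENNReal.mul_inv_cancel (by exact_mod_cast hM) ENNReal.coe_ne_top
    calc _ = ((M : ℝ≥0∞) * (M : ℝ≥0∞)⁻¹) * ((b z * f z : ℝ≥0∞) *
          (ENNReal.ofReal (((4 : ℝ) ^ (J - k)) ^ α) * boxAvg e (J - k) g z)) := by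
          rw [hMM, one_mul]
      _ = _ := by ring
  simp only [hsum]
  have hfG : Measurable fun z => (f z : ℝ≥0∞) * G z := hf.coe_nnreal_ennreal.mul hGm
  rw [lintegral_const_mul _ hfG, Measure.volume_eq_prod, lintegral_prod _ hfG.aemeasurable]
  have hmain := hC (timeGrid e.1 J) (spaceGrid e.2 J) c g hcm hg (fun t k x => by
    simp only [hcτ]
    exact setLIntegral_spaceGrid_cell_le hα hp₀ hM (hbM t) e.2 J k x)
  calc (M : ℝ≥0∞) * ∫⁻ t, ∫⁻ x, (f (t, x) : ℝ≥0∞) * G (t, x)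
      ≤ M * ((∫⁻ t, (∫⁻ x, (f (t, x) : ℝ≥0∞) ^ s) ^ (r / s)) ^ (1 / r) *
        (∫⁻ t, (∫⁻ x, G (t, x) ^ s') ^ (r' / s')) ^ (1 / r')) := by
        gcongr
        exact lintegral_lintegral_mul_le_mixed volume volume hr hs
          (F := fun z => (f z : ℝ≥0∞)) hf.coe_nnreal_ennreal hGm
    _ ≤ M * ((∫⁻ t, (∫⁻ x, (f (t, x) : ℝ≥0∞) ^ s) ^ (r / s)) ^ (1 / r) *
        (C * ∫⁻ t, (∫⁻ x, g (t, x) ^ s') ^ (r' / s')) ^ (1 / r')) := by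
        gcongr
    _ = _ := by
        rw [ENNReal.mul_rpow_of_nonneg _ _ (by positivity),
          ENNReal.coe_rpow_of_nonneg _ (by positivity : (0 : ℝ) ≤ 1 / r')]
        ring

/-- The potential estimate for measurable functions and a positive finite Morrey bound. -/
theorem exists_mixedNorm_parabolicPotential_le {d : ℕ} {p₀ α k r s r' s' : ℝ} (hα : 0 < α)
    (hαd : α < d + 2) (hk : 0 < k) (hr : r.HolderConjugate r') (hs : s.HolderConjugate s')
    (hs' : s' < p₀) :
    ∃ N : ℝ≥0, ∀ (b f : SpaceTime d → ℝ≥0) (M : ℝ≥0), Measurable b → Measurable f → M ≠ 0 →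
      (∀ (t ρ : ℝ) (x : EuclideanSpace ℝ (Fin d)), 0 < ρ →
        ∫⁻ y in Metric.ball x ρ, (b (t, y) : ℝ≥0∞) ^ p₀ ≤
          volume (Metric.ball x ρ) * (M * ENNReal.ofReal (ρ ^ (-α))) ^ p₀) →
      mixedNorm r s (parabolicPotential α k fun z => (b z * f z : ℝ≥0∞)) ≤
        N * M * mixedNorm r s fun z => (f z : ℝ≥0∞) := by
  obtain ⟨N, hN⟩ := exists_lintegral_mul_tsum_boxAvg_le (d := d) hα hr hs hs'
  obtain ⟨C, hC⟩ := exists_lintegral_parabolicKernel_mul_le d hk hαd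
  refine ⟨C * (Fintype.card (Bool × (Fin d → Bool)) * N), fun b f M hb hf hM hbM => ?_⟩
  have hbm : Measurable fun z => (b z * f z : ℝ≥0∞) :=
    hb.coe_nnreal_ennreal.mul hf.coe_nnreal_ennreal
  have hPm := measurable_parabolicPotential α k hbm
  simp only [mixedNorm, enorm_eq_self]
  refine mixed_norm_le_of_forall_lintegral_mul_le volume volume hr hs hPm fun g hg => ?_
  have hPg : Measurable fun z => parabolicPotential α k (fun z => (b z * f z : ℝ≥0∞)) z * g z :=
    hPm.mul hg
  rw [← lintegral_prod _ hPg.aemeasurable, ← Measure.volume_eq_prod,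
    lintegral_parabolicPotential_mul α k hbm hg]
  have hum : ∀ e : Bool × (Fin d → Bool), Measurable fun z : SpaceTime d => (b z * f z : ℝ≥0∞) *
      ∑' j : ℤ, ENNReal.ofReal (((4 : ℝ) ^ j) ^ α) * boxAvg e j g z := fun e =>
    hbm.mul (Measurable.tsum fun j => (measurable_boxAvg e j hg).const_mul _)
  calc _ ≤ ∫⁻ z, (b z * f z : ℝ≥0∞) * (C * ∑ e : Bool × (Fin d → Bool), ∑' j : ℤ,
          ENNReal.ofReal (((4 : ℝ) ^ j) ^ α) * boxAvg e j g z) := by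
        gcongr with z
        exact hC g hg z
    _ = C * ∑ e : Bool × (Fin d → Bool), ∫⁻ z, (b z * f z : ℝ≥0∞) *
          ∑' j : ℤ, ENNReal.ofReal (((4 : ℝ) ^ j) ^ α) * boxAvg e j g z := by
        rw [← lintegral_finsetSum _ fun e _ => hum e, ← lintegral_const_mul' _ _ ENNReal.coe_ne_top]
        refine lintegral_congr fun z => ?_
        rw [← Finset.mul_sum, mul_left_comm]
    _ ≤ C * ∑ _e : Bool × (Fin d → Bool), N * M *
          (∫⁻ t, (∫⁻ x, (f (t, x) : ℝ≥0∞) ^ s) ^ (r / s)) ^ (1 / r) *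
          (∫⁻ t, (∫⁻ x, g (t, x) ^ s') ^ (r' / s')) ^ (1 / r') := by
        gcongr with e
        exact hN b f g M hb hf hg hM hbM e
    _ = _ := by
        rw [Finset.sum_const, nsmul_eq_mul, Finset.card_univ]
        push_cast
        ring

/-! ### Null sets, degenerate Morrey norms, and the main theorem. -/

theorem parabolicPotential_congr {d : ℕ} (α k : ℝ) {g h : SpaceTime d → ℝ≥0∞}
    (hgh : g =ᵐ[volume] h) : parabolicPotential α k g = parabolicPotential α k h := by
  funext z
  unfold parabolicPotential
  have : (volume : Measure (SpaceTime d)).IsAddLeftInvariant := by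
    rw [Measure.volume_eq_prod]; infer_instance
  have hq := (measurePreserving_add_left (volume : Measure (SpaceTime d)) z).quasiMeasurePreserving
  refine lintegral_congr_ae ?_
  filter_upwards [hq.ae_eq_comp hgh] with w hw
  congr 1

theorem mixedNorm_congr {d : ℕ} {V W : Type*} [ENorm V] [ENorm W] (r s : ℝ)
    {f : SpaceTime d → V} {g : SpaceTime d → W} (hfg : ∀ᵐ z, ‖f z‖ₑ = ‖g z‖ₑ) :
    mixedNorm r s f = mixedNorm r s g := by
  unfold mixedNorm
  congr 1
  refine lintegral_congr_ae ?_
  rw [Measure.volume_eq_prod] at hfg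
  filter_upwards [Measure.ae_ae_of_ae_prod hfg] with t ht
  congr 1
  refine lintegral_congr_ae ?_
  filter_upwards [ht] with x hx
  rw [hx]

theorem mixedNorm_parabolicPotential_eq_zero {d : ℕ} {α k r s : ℝ} (hr : 0 < r) (hs : 0 < s)
    {h : SpaceTime d → ℝ≥0∞} (hh : h =ᵐ[volume] 0) :
    mixedNorm r s (parabolicPotential α k h) = 0 := by
  rw [parabolicPotential_congr α k hh]
  have : parabolicPotential α k (0 : SpaceTime d → ℝ≥0∞) = 0 := by
    funext z; simp [parabolicPotential]
  rw [this]
  simp [mixedNorm, hr, hs, div_pos hr hs]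

theorem ae_eq_zero_of_mixedNorm_eq_zero {d : ℕ} {r s : ℝ} (hr : 0 < r) (hs : 0 < s)
    {f : SpaceTime d → ℝ≥0} (hf : Measurable f)
    (h : mixedNorm r s (fun z => (f z : ℝ≥0∞)) = 0) : f =ᵐ[volume] 0 := by
  simp only [mixedNorm, enorm_eq_self] at h
  have hfs : Measurable fun z : SpaceTime d => (f z : ℝ≥0∞) ^ s := hf.coe_nnreal_ennreal.pow_const s
  have h1 : ∫⁻ t : ℝ, (∫⁻ x, (f (t, x) : ℝ≥0∞) ^ s) ^ (r / s) = 0 :=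
    (ENNReal.rpow_eq_zero_iff_of_pos (by positivity)).1 h
  rw [lintegral_eq_zero_iff (hfs.lintegral_prod_right'.pow_const _)] at h1
  have h2 : ∫⁻ z : SpaceTime d, (f z : ℝ≥0∞) ^ s = 0 := by
    rw [Measure.volume_eq_prod, lintegral_prod _ hfs.aemeasurable,
      lintegral_eq_zero_iff hfs.lintegral_prod_right']
    filter_upwards [h1] with t ht
    exact (ENNReal.rpow_eq_zero_iff_of_pos (div_pos hr hs)).1 ht
  rw [lintegral_eq_zero_iff hfs] at h2
  filter_upwards [h2] with z hz
  exact_mod_cast (ENNReal.rpow_eq_zero_iff_of_pos hs).1 hz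

theorem setLIntegral_ball_le_of_morreyNorm_le {d : ℕ} {V : Type*} [ENorm V] {α p₀ : ℝ}
    (hp₀ : 0 < p₀) {b : SpaceTime d → V} {M : ℝ≥0} (hM : morreyNorm α p₀ b ≤ M) (t : ℝ) {ρ : ℝ}
    (hρ : 0 < ρ) (x : EuclideanSpace ℝ (Fin d)) :
    ∫⁻ y in Metric.ball x ρ, ‖b (t, y)‖ₑ ^ p₀ ≤
      volume (Metric.ball x ρ) * (M * ENNReal.ofReal (ρ ^ (-α))) ^ p₀ := by
  have h1 : ENNReal.ofReal (ρ ^ α) *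
      (⨍⁻ y in Metric.ball x ρ, ‖b (t, y)‖ₑ ^ p₀ ∂volume) ^ (1 / p₀) ≤ M := by
    refine le_trans ?_ hM
    unfold morreyNorm
    exact le_iSup_of_le t (le_iSup_of_le ρ (le_iSup_of_le hρ (le_iSup_of_le x le_rfl)))
  rw [setLAverage_eq] at h1
  have hv0 : volume (Metric.ball x ρ) ≠ 0 := (Metric.measure_ball_pos _ _ hρ).ne'
  have hvt : volume (Metric.ball x ρ) ≠ ∞ := measure_ball_lt_top.ne
  have h2 : ENNReal.ofReal (ρ ^ (-α)) * ENNReal.ofReal (ρ ^ α) = 1 := by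
    rw [← ENNReal.ofReal_mul (by positivity), ← Real.rpow_add hρ]; simp
  have h3 : ((∫⁻ y in Metric.ball x ρ, ‖b (t, y)‖ₑ ^ p₀) / volume (Metric.ball x ρ)) ^ (1 / p₀) ≤
      M * ENNReal.ofReal (ρ ^ (-α)) := by
    calc _ = ENNReal.ofReal (ρ ^ (-α)) * (ENNReal.ofReal (ρ ^ α) *
          ((∫⁻ y in Metric.ball x ρ, ‖b (t, y)‖ₑ ^ p₀) / volume (Metric.ball x ρ)) ^ (1 / p₀)) := by
          rw [← mul_assoc, h2, one_mul]
      _ ≤ ENNReal.ofReal (ρ ^ (-α)) * M := by gcongr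
      _ = _ := mul_comm _ _
  have h4 := ENNReal.rpow_le_rpow h3 hp₀.le
  rw [← ENNReal.rpow_mul, one_div_mul_cancel hp₀.ne', ENNReal.rpow_one,
    ENNReal.div_le_iff hv0 hvt] at h4
  rwa [mul_comm] at h4

/-- A function which is measurable up to a null set has a measurable version that satisfies, at
every time, the same bounds for means over balls. -/
theorem exists_measurable_version {d : ℕ} {p₀ : ℝ} (hp₀ : 0 < p₀) {b : SpaceTime d → ℝ}
    (hb : AEMeasurable b volume) (hb0 : ∀ z, 0 ≤ b z) :
    ∃ b' : SpaceTime d → ℝ≥0, Measurable b' ∧ (∀ᵐ z, (b' z : ℝ≥0∞) = ENNReal.ofReal (b z)) ∧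
      ∀ t, ∀ A : Set (EuclideanSpace ℝ (Fin d)),
        ∫⁻ y in A, (b' (t, y) : ℝ≥0∞) ^ p₀ ≤ ∫⁻ y in A, ‖b (t, y)‖ₑ ^ p₀ := by
  classical
  have hae : ∀ᵐ t : ℝ, ∀ᵐ y : EuclideanSpace ℝ (Fin d), b (t, y) = hb.mk b (t, y) :=
    Measure.ae_ae_of_ae_prod (μ := volume) (ν := volume) hb.ae_eq_mk
  -- The Morrey norm is a supremum over every time, so a change on a null set could increase it.
  -- Setting the version to 0 on the exceptional null set of times can only lower its means, and at
  -- all other times it agrees with `b` almost everywhere in space.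
  set Z : Set ℝ := toMeasurable volume {t | ¬ ∀ᵐ y : EuclideanSpace ℝ (Fin d),
    b (t, y) = hb.mk b (t, y)} with hZ
  have hZm : MeasurableSet Z := measurableSet_toMeasurable _ _
  have hZ0 : volume Z = 0 := by rw [hZ, measure_toMeasurable]; exact hae
  have hgood : ∀ t ∉ Z, ∀ᵐ y : EuclideanSpace ℝ (Fin d), b (t, y) = hb.mk b (t, y) := by
    intro t ht
    by_contra hcon
    exact ht (subset_toMeasurable _ _ hcon)
  have hZae : ∀ᵐ z : SpaceTime d, z.1 ∉ Z := by
    have h1 : ∀ᵐ t : ℝ, t ∉ Z := measure_eq_zero_iff_ae_notMem.1 hZ0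
    rw [Measure.volume_eq_prod]
    exact Measure.quasiMeasurePreserving_fst.ae h1
  refine ⟨fun z => if z.1 ∈ Z then 0 else (hb.mk b z).toNNReal, ?_, ?_, ?_⟩
  · exact Measurable.ite (measurable_fst hZm) measurable_const hb.measurable_mk.real_toNNReal
  · filter_upwards [hZae, hb.ae_eq_mk] with z hz hbz
    rw [if_neg hz, hbz]; rfl
  · intro t A
    by_cases ht : t ∈ Z
    · simp [ht, hp₀]
    · refine lintegral_mono_ae (ae_restrict_of_ae ?_)
      filter_upwards [hgood t ht] with y hy
      simp only [ht, if_false]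
      rw [← hy, Real.enorm_eq_ofReal (hb0 _)]
      exact le_rfl

/-- The balls centered at 0 exhaust space, so every time slice has zero integral. This settles the
case of a vanishing Morrey norm, where division by `M` is impossible. -/
theorem ae_eq_zero_of_forall_setLIntegral_ball_eq_zero {d : ℕ} {p₀ : ℝ} (hp₀ : 0 < p₀)
    {b : SpaceTime d → ℝ≥0} (hb : Measurable b)
    (h : ∀ (t ρ : ℝ), 0 < ρ → ∫⁻ y in Metric.ball 0 ρ, (b (t, y) : ℝ≥0∞) ^ p₀ = 0) :
    b =ᵐ[volume] 0 := by
  have hbp : Measurable fun z : SpaceTime d => (b z : ℝ≥0∞) ^ p₀ :=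
    hb.coe_nnreal_ennreal.pow_const p₀
  have h1 : ∀ t : ℝ, ∫⁻ y, (b (t, y) : ℝ≥0∞) ^ p₀ = 0 := by
    intro t
    have hm : Monotone fun n : ℕ => Metric.ball (0 : EuclideanSpace ℝ (Fin d)) (n + 1) := by
      intro i j hij
      exact Metric.ball_subset_ball (by gcongr)
    rw [← setLIntegral_univ, ← Metric.iUnion_ball_nat_succ (0 : EuclideanSpace ℝ (Fin d)),
      setLIntegral_iUnion_of_directed _ hm.directed_le]
    simp [h t _ (Nat.cast_add_one_pos _)]
  have h2 : ∫⁻ z : SpaceTime d, (b z : ℝ≥0∞) ^ p₀ = 0 := by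
    rw [Measure.volume_eq_prod, lintegral_prod _ hbp.aemeasurable]
    simp [h1]
  rw [lintegral_eq_zero_iff hbp] at h2
  filter_upwards [h2] with z hz
  exact_mod_cast (ENNReal.rpow_eq_zero_iff_of_pos hp₀).1 hz

theorem theorem2p2 (d : ℕ) (p₀ α k r s : ℝ)
    (hp₀ : 1 < p₀) (hp₀d : p₀ ≤ (d : ℝ))
    (hα : 0 < α) (hαd : α ≤ (d : ℝ) / p₀) (hk : 0 < k)
    (hr : p₀ / (p₀ - 1) < r) (hs : p₀ / (p₀ - 1) < s) :
    ∃ N : ℝ≥0, ∀ b f : SpaceTime d → ℝ,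
      AEMeasurable b volume → AEMeasurable f volume →
      (∀ z, 0 ≤ b z) → (∀ z, 0 ≤ f z) →
      mixedNorm r s (parabolicPotential α k (fun z => ENNReal.ofReal (b z * f z)))
        ≤ N * morreyNorm α p₀ b * mixedNorm r s f := by
  have hp₀0 : 0 < p₀ := by linarith
  have hp₀1 : 0 < p₀ - 1 := by linarith
  have hconj : 1 < p₀ / (p₀ - 1) := by rw [one_lt_div hp₀1]; linarith
  have hr1 : 1 < r := hconj.trans hr
  have hs1 : 1 < s := hconj.trans hs
  have hr0 : 0 < r := by linarith
  have hs0 : 0 < s := by linarith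
  have hαd' : α < d + 2 := by
    have : (d : ℝ) / p₀ ≤ d := div_le_self (Nat.cast_nonneg d) hp₀.le
    linarith
  -- Conjugation reverses order: `s > p₀ / (p₀ - 1)` means `s' < p₀`, the room needed for the
  -- geometric summation.
  have hs' : s.conjExponent < p₀ := by
    rw [Real.conjExponent, div_lt_iff₀ (by linarith)]
    rw [div_lt_iff₀ hp₀1] at hs
    linarith
  obtain ⟨N, hN⟩ := exists_mixedNorm_parabolicPotential_le (d := d) hα hαd' hk
    (Real.HolderConjugate.conjExponent hr1) (Real.HolderConjugate.conjExponent hs1) hs'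
  -- A nonzero constant makes the right-hand side infinite when the Morrey norm is infinite and `f`
  -- is not almost everywhere zero.
  refine ⟨N + 1, fun b f hb hf hb0 hf0 => ?_⟩
  obtain ⟨b', hb'm, hb'b, hb'le⟩ := exists_measurable_version hp₀0 hb hb0
  obtain ⟨f', hf'm, hf'f, -⟩ := exists_measurable_version hp₀0 hf hf0
  have hbf : (fun z => ENNReal.ofReal (b z * f z)) =ᵐ[volume]
      fun z => (b' z * f' z : ℝ≥0∞) := by
    filter_upwards [hb'b, hf'f] with z h1 h2
    rw [h1, h2, ENNReal.ofReal_mul (hb0 z)]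
  have hnorm : mixedNorm r s f = mixedNorm r s fun z => (f' z : ℝ≥0∞) := by
    refine mixedNorm_congr r s ?_
    filter_upwards [hf'f] with z hz
    rw [enorm_eq_self, hz, Real.enorm_eq_ofReal (hf0 z)]
  rw [parabolicPotential_congr α k hbf, hnorm]
  have hball : ∀ M : ℝ≥0, morreyNorm α p₀ b ≤ M →
      ∀ (t ρ : ℝ) (x : EuclideanSpace ℝ (Fin d)), 0 < ρ →
        ∫⁻ y in Metric.ball x ρ, (b' (t, y) : ℝ≥0∞) ^ p₀ ≤
          volume (Metric.ball x ρ) * (M * ENNReal.ofReal (ρ ^ (-α))) ^ p₀ := fun M hM t ρ x hρ =>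
    (hb'le t _).trans (setLIntegral_ball_le_of_morreyNorm_le hp₀0 hM t hρ x)
  have hN1 : ((N + 1 : ℝ≥0) : ℝ≥0∞) ≠ 0 := by simp
  by_cases htop : morreyNorm α p₀ b = ∞
  · by_cases hz : mixedNorm r s (fun z => (f' z : ℝ≥0∞)) = 0
    · refine (mixedNorm_parabolicPotential_eq_zero hr0 hs0 ?_).trans_le bot_le
      filter_upwards [ae_eq_zero_of_mixedNorm_eq_zero hr0 hs0 hf'm hz] with z hz
      simp [hz]
    · rw [htop, ENNReal.mul_top hN1, ENNReal.top_mul hz]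
      exact le_top
  by_cases hzero : morreyNorm α p₀ b = 0
  · refine (mixedNorm_parabolicPotential_eq_zero hr0 hs0 ?_).trans_le bot_le
    have hb'0 : b' =ᵐ[volume] 0 :=
      ae_eq_zero_of_forall_setLIntegral_ball_eq_zero hp₀0 hb'm fun t ρ hρ => by
        have := hball 0 (by simp [hzero]) t ρ 0 hρ
        simpa [hp₀0] using this
    filter_upwards [hb'0] with z hz
    simp [hz]
  · lift morreyNorm α p₀ b to ℝ≥0 using htop with M hM
    refine (hN b' f' M hb'm hf'm (by simpa using hzero) (hball M le_rfl)).trans ?_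
    gcongr
    simp
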